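/- Work in the language of arithmetic $\{+,\cdot,<,0,1\}$. Let $M$ be a nonstandard model of $\mathrm{I}\Sigma_1$, that is, of $\mathrm{PA}^-$ together with induction for $\Sigma_1$-formulas with parameters. Elements of $M$ code sets by Ackermann's relation $x\mathrel{E}y$ ("the $x$-th bit of the binary expansion of $y$ is $1$"). An element $f\in M$ is a coded function if the set $\{z\in M: z\mathrel{E}f\}$ is the graph of a function (with respect to a standard pairing function), and a sequence number is a coded function $a$ with domain $\{i\in M: i<l\}$ for some $l\in M$; its value at $i$ is written $(a)_i$. A proper cut of $M$ is a nonempty proper subset $I\subsetneq M$ that is downward closed and closed under $x\mapsto x+1$. It is called strong in $M$ if for every coded function $f$ of $M$ whose domain contains $I$ there is $e\in M$ with $e>i$ for all $i\in I$ such that, for all $i\in I$, $f(i)\in I$ if and only if $f(i)<e$. A set $X\subseteq M$ is called $I$-small in $M$ if there is a sequence number $a\in M$, with $(a)_i$ defined for all $i\in I$, such that $X=\{(a)_i : i\in I\}$ and $(a)_i\neq (a)_j$ for all distinct $i,j\in I$. The standard cut $\mathbb N$ of $M$ is the set of values of the numerals, and small means $\mathbb N$-small. Lemma 3.1. Let $M$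 be a nonstandard model of $\mathrm{I}\Sigma_1$, let $I$ be a proper cut of $M$, and let $M_0$ be a submodel (substructure) of $M$ such that $M_0=\{(a)_i : i\in I\}$ for some sequence number $a\in M$ with $(a)_i$ defined for all $i\in I$. Then: (1) if $I=\mathbb N$, then $M_0$ is small in $M$; (2) if $I$ is strong in $M$, then $M_0$ is $I$-small in $M$. -/

import Mathlib

namespace Arith

open FirstOrder FirstOrder.Language

/-! ### The language of arithmetic and its structures -/

/-- Function symbols of the language of arithmetic: `0`, `1`, `+`, `·`. -/
inductive Func : ℕ → Type
  | zero : Func 0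
  | one : Func 0
  | add : Func 2
  | mul : Func 2

/-- The only relation symbol of the language of arithmetic: `<`. -/
inductive Rel : ℕ → Type
  | lt : Rel 2

/-- The language of arithmetic `{+, ·, <, 0, 1}`. -/
def arith : FirstOrder.Language.{0, 0} := ⟨Func, Rel⟩

/-- A type with `0`, `1`, `+`, `·`, `<` (no laws are assumed) is the same thing as a structure for
the language of arithmetic. -/
instance arithStructure {M : Type*} [Zero M] [One M] [Add M] [Mul M] [LT M] :
    arith.Structure M where
  funMap {_} f v := match f, v with
    | Func.zero, _ => 0
    | Func.one, _ => 1
    | Func.add, v => v 0 + v 1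
    | Func.mul, v => v 0 * v 1
  RelMap {_} r v := match r, v with
    | Rel.lt, v => v 0 < v 1

/-! ### Bounded formulas, `Σ₁` formulas and the theory `IΣ₁` -/

/-- The formula `x < t`, where `x` is the last variable and `t` is a term in which `x` does not
occur. -/
def ltBound {α : Type*} {n : ℕ} (t : arith.Term (α ⊕ Fin n)) :
    arith.BoundedFormula α (n + 1) :=
  Relations.boundedFormula₂ (L := arith) Rel.lt
    (Term.var (Sum.inr (Fin.last n))) (t.relabel (Sum.map id Fin.castSucc))

/-- `Δ₀` formulas: all quantifiers are bounded, i.e. of the form `∀ x < t` or `∃ x < t` where the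
term `t` does not contain `x`. -/
inductive IsDelta0 {α : Type*} : ∀ {n : ℕ}, arith.BoundedFormula α n → Prop
  | falsum {n : ℕ} : IsDelta0 (BoundedFormula.falsum : arith.BoundedFormula α n)
  | equal {n : ℕ} (t₁ t₂ : arith.Term (α ⊕ Fin n)) : IsDelta0 (BoundedFormula.equal t₁ t₂)
  | rel {n l : ℕ} (R : arith.Relations l) (ts : Fin l → arith.Term (α ⊕ Fin n)) :
      IsDelta0 (BoundedFormula.rel R ts)
  | imp {n : ℕ} {φ ψ : arith.BoundedFormula α n} :
      IsDelta0 φ → IsDelta0 ψ → IsDelta0 (φ.imp ψ)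
  | ball {n : ℕ} (t : arith.Term (α ⊕ Fin n)) {φ : arith.BoundedFormula α (n + 1)} :
      IsDelta0 φ → IsDelta0 ((ltBound t).imp φ).all
  | bex {n : ℕ} (t : arith.Term (α ⊕ Fin n)) {φ : arith.BoundedFormula α (n + 1)} :
      IsDelta0 φ → IsDelta0 (ltBound t ⊓ φ).ex

/-- `Σ₁` formulas: a block of existential quantifiers in front of a `Δ₀` formula. -/
inductive IsSigma1 {α : Type*} : ∀ {n : ℕ}, arith.BoundedFormula α n → Prop
  | delta0 {n : ℕ} {φ : arith.BoundedFormula α n} : IsDelta0 φ → IsSigma1 φ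
  | ex {n : ℕ} {φ : arith.BoundedFormula α (n + 1)} : IsSigma1 φ → IsSigma1 φ.ex

/-- `M` is a model of `PA⁻`, i.e. the nonnegative part of a discretely ordered ring. -/
structure PAMinus (M : Type*) [Zero M] [One M] [Add M] [Mul M] [LT M] : Prop where
  add_assoc : ∀ x y z : M, (x + y) + z = x + (y + z)
  add_comm : ∀ x y : M, x + y = y + x
  mul_assoc : ∀ x y z : M, (x * y) * z = x * (y * z)
  mul_comm : ∀ x y : M, x * y = y * x
  mul_add : ∀ x y z : M, x * (y + z) = x * y + x * z
  add_zero : ∀ x : M, x + 0 = x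
  mul_zero : ∀ x : M, x * 0 = 0
  mul_one : ∀ x : M, x * 1 = x
  lt_irrefl : ∀ x : M, ¬ x < x
  lt_trans : ∀ x y z : M, x < y → y < z → x < z
  lt_trichotomy : ∀ x y : M, x < y ∨ x = y ∨ y < x
  add_lt_add : ∀ x y z : M, x < y → x + z < y + z
  mul_lt_mul : ∀ x y z : M, 0 < z → x < y → x * z < y * z
  exists_add_of_lt : ∀ x y : M, x < y → ∃ z, x + z = y
  zero_lt_one : (0 : M) < 1
  one_le_of_pos : ∀ x : M, 0 < x → 1 = x ∨ 1 < x
  zero_le : ∀ x : M, 0 = x ∨ 0 < x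

/-- `M` is a model of `IΣ₁`: a model of `PA⁻` that satisfies the induction axiom for every `Σ₁`
formula `φ(x)` with parameters from `M`. (The free variables of `φ` other than `x` are named by
elements of `M`, and each of them is assigned the element that names it.) -/
structure ISigma1 (M : Type*) [Zero M] [One M] [Add M] [Mul M] [LT M] : Prop
    extends PAMinus M where
  induction : ∀ φ : arith.BoundedFormula M 1, IsSigma1 φ →
    φ.Realize id ![0] →
    (∀ x : M, φ.Realize id ![x] → φ.Realize id ![x + 1]) →
    ∀ x : M, φ.Realize id ![x]

section

variable {M : Type*} [Zero M] [One M] [Add M] [Mul M] [LT M]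

/-! ### Cuts -/

/-- The value in `M` of the `n`-th numeral `0 + 1 + ⋯ + 1`. -/
def numeral (M : Type*) [Zero M] [One M] [Add M] : ℕ → M
  | 0 => 0
  | n + 1 => numeral M n + 1

/-- The standard cut `ℕ` of `M`. -/
def standardCut (M : Type*) [Zero M] [One M] [Add M] : Set M := Set.range (numeral M)

/-- `M` has an element that is not the value of a numeral. -/
def IsNonstandard (M : Type*) [Zero M] [One M] [Add M] : Prop := ∃ c : M, c ∉ standardCut M

/-- `I` is a proper cut of `M`: a nonempty proper subset that is an initial segment and is closed
under successor. -/
structure IsProperCut (I : Set M) : Prop where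
  nonempty : I.Nonempty
  initial : ∀ x y : M, x < y → y ∈ I → x ∈ I
  succ_mem : ∀ x : M, x ∈ I → x + 1 ∈ I
  proper : I ≠ Set.univ

/-! ### Coding of sets, functions and sequences -/

/-- Gödel's `β` function: `z` is the remainder of `u` upon division by `(i + 1) v + 1`. -/
def Beta (u v i z : M) : Prop :=
  z < (i + 1) * v + 1 ∧ ∃ q : M, u = q * ((i + 1) * v + 1) + z

/-- `y = 2 ^ x` in `M`: some `β`-coded computation starts with `1`, doubles at each of the first
`x` steps and has `y` as its entry number `x`. -/
def IsPowTwo (x y : M) : Prop :=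
  ∃ u v : M, Beta u v 0 1 ∧
    (∀ i : M, i < x → ∃ z : M, Beta u v i z ∧ Beta u v (i + 1) ((1 + 1) * z)) ∧
    Beta u v x y

/-- Ackermann's membership relation `x E y`: the bit number `x` of the binary expansion of `y`
is `1`. -/
def AckMem (x y : M) : Prop :=
  ∃ p q r : M, IsPowTwo x p ∧ r < p ∧ y = ((1 + 1) * q + 1) * p + r

/-- An ordered pair function. -/
def pair (x y : M) : M := (x + y + 1) * (x + y + 1) + x

/-- The pair of `x` and `y` belongs to the set coded by `f`. If `f` codes a function, this says
`f(x) = y`; if `f` is a sequence number, it says `(f)_x = y`. -/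
def Maps (f x y : M) : Prop := AckMem (pair x y) f

/-- The set coded by `f` is (the graph of) a function. -/
def IsCodedFunction (f : M) : Prop :=
  (∀ z : M, AckMem z f → ∃ x y : M, z = pair x y) ∧
    ∀ x y y' : M, Maps f x y → Maps f x y' → y = y'

/-- The domain of the function coded by `f`. -/
def dom (f : M) : Set M := {x | ∃ y : M, Maps f x y}

/-- `a` is a sequence number: it codes a function with domain `{i | i < l}` for some `l`,
the length of `a`. -/
def IsSeq (a : M) : Prop :=
  IsCodedFunction a ∧ ∃ l : M, ∀ i : M, i ∈ dom a ↔ i < l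

/-- `a` is a sequence number, `(a)_i` is defined for all `i ∈ I`, and `X = {(a)_i | i ∈ I}`. -/
def Enumerates (a : M) (I X : Set M) : Prop :=
  IsSeq a ∧ I ⊆ dom a ∧ X = {x | ∃ i ∈ I, Maps a i x}

/-! ### Small sets and strong cuts -/

/-- `X` is `I`-small in `M`: `X = {(a)_i | i ∈ I}` for some `a` such that `(a)_i ≠ (a)_j` for all
distinct `i, j ∈ I`. -/
def IsISmall (I X : Set M) : Prop :=
  ∃ a : M, Enumerates a I X ∧
    ∀ i ∈ I, ∀ j ∈ I, i ≠ j → ∀ x y : M, Maps a i x → Maps a j y → x ≠ y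

/-- `X` is small in `M`: it is `ℕ`-small. -/
def IsSmall (X : Set M) : Prop := IsISmall (standardCut M) X

/-- The cut `I` is strong in `M`: for every coded function `f` whose domain contains `I` there is
some `e > I` such that, for all `i ∈ I`, `f(i) ∈ I` if and only if `f(i) < e`. -/
def IsStrong (I : Set M) : Prop :=
  ∀ f : M, IsCodedFunction f → I ⊆ dom f →
    ∃ e : M, (∀ i ∈ I, i < e) ∧ ∀ i ∈ I, ∀ y : M, Maps f i y → (y ∈ I ↔ y < e)

end

end Arith

set_option linter.unusedSectionVars false

/-! Let `A` be the function enumerating the submodel. Call an index new if its value was not taken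
earlier, and let `c k` be the number of new indices below `k`. Sending `i` to the value at the new
index `k` with `c k = i` gives a coded injective sequence. Since `c k ≤ k`, every value of `A` on
`I` already occurs in it at a place in `I`. Conversely, its places in `I` yield only values of `A`
on `I` as soon as `c` is cofinal in `I` on `I` (`IsCount.isISmall`).

Cofinality rests on closure of the submodel under successor. For `k` in `I`, the maximum of `A`
below `k`, plus one, is again a value on `I`, and its first occurrence is a new index not below `k`
(`IsCount.exists_isNew_ge`). Hence the set of `i` with `i < c k` for some `k ∈ I` contains `0` and
is closed under successor. For the standard cut, ordinary induction on numerals finishes the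
argument. For a strong cut, let `f i` be the least `k` with `i < c k`. Strength replaces the
external condition `f i ∈ I` by `f i < e`, and `Σ₁` induction inside the model applies
(`IsCount.cofinal_of_isStrong`).

All this needs `A`, newness and `c` to be definable and codable. The supporting theory develops
semantic `Σ₁` and `Δ₁` classes, the `β` lemma, primitive recursion, exponentiation and bounded `Δ₁`
comprehension from `Σ₁` induction. -/

namespace Arith

open FirstOrder FirstOrder.Language

/-! ### Semantic definability classes -/

section Definability

variable {M : Type*} [CommSemiring M] [LinearOrder M] {n m : ℕ}

/-- Functions given by terms with parameters. -/
inductive IsPoly : ∀ {n : ℕ}, ((Fin n → M) → M) → Prop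
  | var {n : ℕ} (i : Fin n) : IsPoly (fun v : Fin n → M => v i)
  | const {n : ℕ} (c : M) : IsPoly (fun _ : Fin n → M => c)
  | add {n : ℕ} {f g : (Fin n → M) → M} : IsPoly f → IsPoly g → IsPoly (fun v => f v + g v)
  | mul {n : ℕ} {f g : (Fin n → M) → M} : IsPoly f → IsPoly g → IsPoly (fun v => f v * g v)

/-- Relations defined by `Δ₀` formulas with parameters. -/
inductive Delta0 : ∀ {n : ℕ}, ((Fin n → M) → Prop) → Prop
  | falsum {n : ℕ} : Delta0 (fun _ : Fin n → M => False)
  | eq {n : ℕ} {f g : (Fin n → M) → M} : IsPoly f → IsPoly g → Delta0 (fun v => f v = g v)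
  | lt {n : ℕ} {f g : (Fin n → M) → M} : IsPoly f → IsPoly g → Delta0 (fun v => f v < g v)
  | imp {n : ℕ} {P Q : (Fin n → M) → Prop} : Delta0 P → Delta0 Q → Delta0 (fun v => P v → Q v)
  | ball {n : ℕ} {f : (Fin n → M) → M} {P : (Fin n → M) → M → Prop} : IsPoly f →
      Delta0 (fun w : Fin (n + 1) → M => P (fun i => w i.castSucc) (w (Fin.last n))) →
      Delta0 (fun v => ∀ x < f v, P v x)

theorem IsPoly.comp {f : (Fin n → M) → M} (hf : IsPoly f) {σ : (Fin m → M) → Fin n → M}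
    (hσ : ∀ i, IsPoly (fun v => σ v i)) : IsPoly (fun v => f (σ v)) := by
  induction hf generalizing m with
  | var i => exact hσ i
  | const c => exact .const c
  | add _ _ ih₁ ih₂ => exact (ih₁ hσ).add (ih₂ hσ)
  | mul _ _ ih₁ ih₂ => exact (ih₁ hσ).mul (ih₂ hσ)

theorem IsPoly.snoc {σ : (Fin m → M) → Fin n → M} (hσ : ∀ i, IsPoly (fun v => σ v i))
    {f : (Fin m → M) → M} (hf : IsPoly f) (i : Fin (n + 1)) :
    IsPoly (fun v => Fin.snoc (α := fun _ => M) (σ v) (f v) i) := by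
  induction i using Fin.lastCases with
  | last => simpa using hf
  | cast i => simpa using hσ i

theorem Delta0.comp {P : (Fin n → M) → Prop} (hP : Delta0 P) {σ : (Fin m → M) → Fin n → M}
    (hσ : ∀ i, IsPoly (fun v => σ v i)) : Delta0 (fun v => P (σ v)) := by
  induction hP generalizing m with
  | falsum => exact .falsum
  | eq hf hg => exact .eq (hf.comp hσ) (hg.comp hσ)
  | lt hf hg => exact .lt (hf.comp hσ) (hg.comp hσ)
  | imp _ _ ih₁ ih₂ => exact (ih₁ hσ).imp (ih₂ hσ)
  | ball hf _ ih =>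
    -- The bound variable is the last coordinate; the substitution is extended by the identity
    -- there.
    refine Delta0.ball (hf.comp hσ) ?_
    have := @ih (m + 1) (fun w => Fin.snoc (α := fun _ => M) (σ fun i => w i.castSucc)
      (w (Fin.last m))) (fun i => IsPoly.snoc
        (fun i => (hσ i).comp (σ := fun w i => w i.castSucc) fun i => .var _) (.var _) i)
    simpa using this

theorem Delta0.not {P : (Fin n → M) → Prop} (hP : Delta0 P) : Delta0 (fun v => ¬ P v) :=
  hP.imp .falsum

theorem Delta0.and {P Q : (Fin n → M) → Prop} (hP : Delta0 P) (hQ : Delta0 Q) :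
    Delta0 (fun v => P v ∧ Q v) := by
  have := (hP.imp hQ.not).not
  simpa using this

theorem Delta0.or {P Q : (Fin n → M) → Prop} (hP : Delta0 P) (hQ : Delta0 Q) :
    Delta0 (fun v => P v ∨ Q v) := by
  have := hP.not.imp hQ
  simpa only [or_iff_not_imp_left] using this

theorem Delta0.bex {f : (Fin n → M) → M} {P : (Fin n → M) → M → Prop} (hf : IsPoly f)
    (hP : Delta0 (fun w : Fin (n + 1) → M => P (fun i => w i.castSucc) (w (Fin.last n)))) :
    Delta0 (fun v => ∃ x < f v, P v x) := by
  have := (Delta0.ball (P := fun v x => ¬ P v x) hf hP.not).not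
  simpa using this

theorem IsPoly.exists_term {f : (Fin n → M) → M} (hf : IsPoly f) :
    ∃ t : arith.Term (M ⊕ Fin n), ∀ v, t.realize (Sum.elim id v) = f v := by
  induction hf with
  | var i => exact ⟨.var (.inr i), fun v => rfl⟩
  | const c => exact ⟨.var (.inl c), fun v => rfl⟩
  | add _ _ ih₁ ih₂ =>
    obtain ⟨t₁, h₁⟩ := ih₁
    obtain ⟨t₂, h₂⟩ := ih₂
    exact ⟨.func (Func.add : arith.Functions 2) ![t₁, t₂], fun v => by
      beta_reduce; rw [← h₁, ← h₂]; rfl⟩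
  | mul _ _ ih₁ ih₂ =>
    obtain ⟨t₁, h₁⟩ := ih₁
    obtain ⟨t₂, h₂⟩ := ih₂
    exact ⟨.func (Func.mul : arith.Functions 2) ![t₁, t₂], fun v => by
      beta_reduce; rw [← h₁, ← h₂]; rfl⟩

theorem realize_ltBound (t : arith.Term (M ⊕ Fin n)) (v : Fin n → M) (x : M) :
    (ltBound t).Realize id (Fin.snoc v x : Fin (n + 1) → M) ↔
      x < t.realize (Sum.elim id v) := by
  change (Term.realize (Sum.elim id (Fin.snoc v x : Fin (n + 1) → M))
      (.var (.inr (Fin.last n)) : arith.Term (M ⊕ Fin (n + 1)))) <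
    (t.relabel (Sum.map id Fin.castSucc)).realize
      (Sum.elim id (Fin.snoc v x : Fin (n + 1) → M)) ↔ _
  rw [Term.realize_relabel, Term.realize_var]
  have : (Sum.elim id (Fin.snoc v x : Fin (n + 1) → M)) ∘ Sum.map id Fin.castSucc
      = Sum.elim id v := by
    funext i
    rcases i with i | i <;> simp
  rw [this]
  simp

/-- The induction axiom speaks of syntactic formulas; this lets all later definability arguments be
carried out on relations instead. -/
theorem Delta0.exists_formula {P : (Fin n → M) → Prop} (hP : Delta0 P) :
    ∃ φ : arith.BoundedFormula M n, IsDelta0 φ ∧ ∀ v, φ.Realize id v ↔ P v := by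
  induction hP with
  | falsum => exact ⟨_, .falsum, fun v => Iff.rfl⟩
  | eq hf hg =>
    obtain ⟨t₁, h₁⟩ := hf.exists_term
    obtain ⟨t₂, h₂⟩ := hg.exists_term
    exact ⟨_, .equal t₁ t₂, fun v => by beta_reduce; rw [← h₁, ← h₂]; rfl⟩
  | lt hf hg =>
    obtain ⟨t₁, h₁⟩ := hf.exists_term
    obtain ⟨t₂, h₂⟩ := hg.exists_term
    exact ⟨_, .rel (Rel.lt : arith.Relations 2) ![t₁, t₂], fun v => by beta_reduce; rw [← h₁, ← h₂]; rfl⟩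
  | imp _ _ ih₁ ih₂ =>
    obtain ⟨φ, hφ, h₁⟩ := ih₁
    obtain ⟨ψ, hψ, h₂⟩ := ih₂
    exact ⟨_, hφ.imp hψ, fun v => by beta_reduce; rw [← h₁, ← h₂]; rfl⟩
  | @ball n f P hf _ ih =>
    obtain ⟨t, ht⟩ := hf.exists_term
    obtain ⟨φ, hφ, h⟩ := ih
    refine ⟨_, .ball t hφ, fun v => ?_⟩
    simp only [BoundedFormula.realize_all, BoundedFormula.realize_imp, realize_ltBound, ht, h]
    simp

/-- Relations defined by `Σ₁` formulas with parameters. -/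
def Sigma1 (P : (Fin n → M) → Prop) : Prop :=
  ∃ Q : (Fin n → M) → M → Prop,
    Delta0 (fun w : Fin (n + 1) → M => Q (fun i => w i.castSucc) (w (Fin.last n))) ∧
    ∀ v, P v ↔ ∃ b, Q v b

theorem Delta0.sigma1 {P : (Fin n → M) → Prop} (hP : Delta0 P) : Sigma1 P :=
  ⟨fun v _ => P v, hP.comp fun i => .var _, fun v => by simp⟩

theorem Sigma1.exists_formula {P : (Fin n → M) → Prop} (hP : Sigma1 P) :
    ∃ φ : arith.BoundedFormula M n, IsSigma1 φ ∧ ∀ v, φ.Realize id v ↔ P v := by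
  obtain ⟨Q, hQ, hPQ⟩ := hP
  obtain ⟨φ, hφ, h⟩ := hQ.exists_formula
  refine ⟨_, .ex (.delta0 hφ), fun v => ?_⟩
  rw [BoundedFormula.realize_ex, hPQ]
  simp [h]

theorem Sigma1.comp {P : (Fin n → M) → Prop} (hP : Sigma1 P) {σ : (Fin m → M) → Fin n → M}
    (hσ : ∀ i, IsPoly (fun v => σ v i)) : Sigma1 (fun v => P (σ v)) := by
  obtain ⟨Q, hQ, hPQ⟩ := hP
  refine ⟨fun v b => Q (σ v) b, ?_, fun v => hPQ _⟩
  have := hQ.comp (σ := fun w : Fin (m + 1) → M => Fin.snoc (α := fun _ => M)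
    (σ fun i => w i.castSucc) (w (Fin.last m))) (fun i => IsPoly.snoc
      (fun i => (hσ i).comp (σ := fun w i => w i.castSucc) fun i => .var _) (.var _) i)
  simpa using this

theorem Sigma1.congr {P Q : (Fin n → M) → Prop} (hP : Sigma1 P) (h : ∀ v, Q v ↔ P v) :
    Sigma1 Q := by
  obtain rfl : Q = P := funext fun v => propext (h v)
  exact hP

theorem delta0_body_bex {Q : (Fin n → M) → M → Prop}
    (hQ : Delta0 (fun w : Fin (n + 1) → M => Q (fun i => w i.castSucc) (w (Fin.last n)))) :
    Delta0 (fun w : Fin (n + 1) → M => ∃ b < w (Fin.last n), Q (fun i => w i.castSucc) b) := by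
  refine Delta0.bex (P := fun w b => Q (fun i => w i.castSucc) b) (.var _) ?_
  have := hQ.comp (σ := fun w : Fin (n + 1 + 1) → M => Fin.snoc (α := fun _ => M)
    (fun i : Fin n => w i.castSucc.castSucc) (w (Fin.last (n + 1))))
    (fun i => IsPoly.snoc (fun i => .var _) (.var _) i)
  simpa using this

end Definability

/-! ### Closure properties of `Σ₁` relations and `Σ₁` induction. -/

section Induction

variable {M : Type*} [CommSemiring M] [LinearOrder M] [IsStrictOrderedRing M]
  [CanonicallyOrderedAdd M] {n m : ℕ}

theorem Sigma1.or {P Q : (Fin n → M) → Prop} (hP : Sigma1 P) (hQ : Sigma1 Q) :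
    Sigma1 (fun v => P v ∨ Q v) := by
  obtain ⟨P', hP', h₁⟩ := hP
  obtain ⟨Q', hQ', h₂⟩ := hQ
  exact ⟨fun v b => P' v b ∨ Q' v b, hP'.or hQ', fun v => by simp [h₁, h₂, exists_or]⟩

theorem Sigma1.and {P Q : (Fin n → M) → Prop} (hP : Sigma1 P) (hQ : Sigma1 Q) :
    Sigma1 (fun v => P v ∧ Q v) := by
  obtain ⟨P', hP', h₁⟩ := hP
  obtain ⟨Q', hQ', h₂⟩ := hQ
  -- A single unbounded witness is allowed, so it serves as a strict bound on both original
  -- witnesses.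
  refine ⟨fun v c => (∃ b < c, P' v b) ∧ (∃ b < c, Q' v b),
    (delta0_body_bex hP').and (delta0_body_bex hQ'), fun v => ?_⟩
  beta_reduce
  rw [h₁, h₂]
  constructor
  · rintro ⟨⟨b, hb⟩, ⟨b', hb'⟩⟩
    exact ⟨max b b' + 1, ⟨b, lt_of_le_of_lt (le_max_left b b') (lt_add_one _), hb⟩,
      ⟨b', lt_of_le_of_lt (le_max_right b b') (lt_add_one _), hb'⟩⟩
  · rintro ⟨c, ⟨b, -, hb⟩, ⟨b', -, hb'⟩⟩
    exact ⟨⟨b, hb⟩, ⟨b', hb'⟩⟩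

theorem Sigma1.ex {P : (Fin n → M) → M → Prop}
    (hP : Sigma1 (fun w : Fin (n + 1) → M => P (fun i => w i.castSucc) (w (Fin.last n)))) :
    Sigma1 (fun v => ∃ x, P v x) := by
  obtain ⟨Q, hQ, hPQ⟩ := hP
  have hPQ' : ∀ v x, P v x ↔ ∃ b, Q (Fin.snoc (α := fun _ => M) v x) b := fun v x => by
    simpa using hPQ (Fin.snoc (α := fun _ => M) v x)
  refine ⟨fun v c => ∃ x < c, ∃ b < c, Q (Fin.snoc (α := fun _ => M) v x) b, ?_, fun v => ?_⟩
  · refine Delta0.bex (P := fun (w : Fin (n + 1) → M) x => ∃ b < w (Fin.last n),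
      Q (Fin.snoc (α := fun _ => M) (fun i : Fin n => w i.castSucc) x) b) (.var _) ?_
    refine Delta0.bex (P := fun (w : Fin (n + 1 + 1) → M) b =>
      Q (Fin.snoc (α := fun _ => M) (fun i : Fin n => w i.castSucc.castSucc)
        (w (Fin.last (n + 1)))) b) (.var _) ?_
    have := hQ.comp (σ := fun w : Fin (n + 1 + 1 + 1) → M => Fin.snoc (α := fun _ => M)
      (Fin.snoc (α := fun _ => M) (fun i : Fin n => w i.castSucc.castSucc.castSucc)
        (w (Fin.last (n + 1)).castSucc)) (w (Fin.last _)))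
      (fun i => IsPoly.snoc (IsPoly.snoc (fun i => .var _) (.var _)) (.var _) i)
    simpa using this
  · constructor
    · rintro ⟨x, hx⟩
      obtain ⟨b, hb⟩ := (hPQ' v x).1 hx
      exact ⟨max x b + 1, x, lt_of_le_of_lt (le_max_left x b) (lt_add_one _), b,
        lt_of_le_of_lt (le_max_right x b) (lt_add_one _), hb⟩
    · rintro ⟨c, x, -, b, -, hb⟩
      exact ⟨x, (hPQ' v x).2 ⟨b, hb⟩⟩

variable [hM : Fact (ISigma1 M)]

theorem lt_add_one_iff' {x y : M} : x < y + 1 ↔ x ≤ y := by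
  constructor
  · intro h
    by_contra! hxy
    obtain ⟨d, rfl⟩ := exists_add_of_le hxy.le
    have hd : 0 < d := by
      rcases hM.out.zero_le d with rfl | h
      · simp at hxy
      · exact h
    have : 1 ≤ d := by
      rcases hM.out.one_le_of_pos d hd with h | h
      · exact h.le
      · exact le_of_lt h
    exact absurd h (not_lt.2 (by gcongr))
  · exact fun h => lt_of_le_of_lt h (lt_add_one y)

theorem add_one_le_iff' {x y : M} : x + 1 ≤ y ↔ x < y := by
  rw [← not_lt, lt_add_one_iff', not_le]

theorem sigma1_induction {P : M → Prop} (hP : Sigma1 (fun v : Fin 1 → M => P (v 0)))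
    (h0 : P 0) (hs : ∀ x, P x → P (x + 1)) (x : M) : P x := by
  obtain ⟨φ, hφ, h⟩ := hP.exists_formula
  have := hM.out.induction φ hφ ((h _).2 h0) (fun x hx => (h _).2 (hs x ((h _).1 hx))) x
  exact (h _).1 this

/-- This is `Σ₁` collection: witnesses for all `x` below the bound are themselves bounded by one
`c`, so the unbounded quantifier can be pulled to the front. -/
theorem Sigma1.ball_poly {f : (Fin n → M) → M} {P : (Fin n → M) → M → Prop} (hf : IsPoly f)
    (hP : Sigma1 (fun w : Fin (n + 1) → M => P (fun i => w i.castSucc) (w (Fin.last n)))) :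
    Sigma1 (fun v => ∀ x < f v, P v x) := by
  obtain ⟨Q, hQ, hPQ⟩ := hP
  have hPQ' : ∀ v x, P v x ↔ ∃ b, Q (Fin.snoc (α := fun _ => M) v x) b := fun v x => by
    simpa using hPQ (Fin.snoc (α := fun _ => M) v x)
  refine ⟨fun v c => ∀ x < f v, ∃ b < c, Q (Fin.snoc (α := fun _ => M) v x) b, ?_, fun v => ?_⟩
  · refine Delta0.ball (P := fun (w : Fin (n + 1) → M) x => ∃ b < w (Fin.last n),
      Q (Fin.snoc (α := fun _ => M) (fun i : Fin n => w i.castSucc) x) b)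
      (hf.comp fun i => .var _) ?_
    refine Delta0.bex (P := fun (w : Fin (n + 1 + 1) → M) b =>
      Q (Fin.snoc (α := fun _ => M) (fun i : Fin n => w i.castSucc.castSucc)
        (w (Fin.last (n + 1)))) b) (.var _) ?_
    have := hQ.comp (σ := fun w : Fin (n + 1 + 1 + 1) → M => Fin.snoc (α := fun _ => M)
      (Fin.snoc (α := fun _ => M) (fun i : Fin n => w i.castSucc.castSucc.castSucc)
        (w (Fin.last (n + 1)).castSucc)) (w (Fin.last _)))
      (fun i => IsPoly.snoc (IsPoly.snoc (fun i => .var _) (.var _)) (.var _) i)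
    simpa using this
  · constructor
    · intro h
      -- The guard sits inside the existential quantifier, so what follows `∃ c` is `Δ₀` and the
      -- statement is `Σ₁`. Past the bound it holds vacuously.
      have key : ∀ z, ∃ c, z < f v + 1 → ∀ x < z, ∃ b < c,
          Q (Fin.snoc (α := fun _ => M) v x) b := by
        refine sigma1_induction ?_ ⟨0, fun _ x hx => absurd hx (not_lt.2 zero_le)⟩ ?_
        · refine ⟨fun w c => w 0 < f v + 1 → ∀ x < w 0, ∃ b < c,
            Q (Fin.snoc (α := fun _ => M) v x) b, ?_, fun v => Iff.rfl⟩
          refine .imp (.lt (.var _) (.const _)) ?_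
          refine Delta0.ball (P := fun (w : Fin (1 + 1) → M) x => ∃ b < w (Fin.last 1),
            Q (Fin.snoc (α := fun _ => M) v x) b) (.var _) ?_
          refine Delta0.bex (P := fun (w : Fin (1 + 1 + 1) → M) b =>
            Q (Fin.snoc (α := fun _ => M) v (w (Fin.last _))) b) (.var _) ?_
          have := hQ.comp (σ := fun w : Fin (1 + 1 + 1 + 1) → M => Fin.snoc (α := fun _ => M)
            (Fin.snoc (α := fun _ => M) v (w (Fin.last (1 + 1)).castSucc)) (w (Fin.last _)))
            (fun i => IsPoly.snoc (IsPoly.snoc (fun i => .const (v i)) (.var _)) (.var _) i)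
          simpa using this
        · rintro z ⟨c, hc⟩
          by_cases hz : z < f v
          · obtain ⟨b, hb⟩ := (hPQ' v z).1 (h z hz)
            refine ⟨max c (b + 1), fun _ x hx => ?_⟩
            rcases (lt_add_one_iff'.1 hx).lt_or_eq with hx | rfl
            · obtain ⟨b', hb', hQ⟩ := hc (hz.trans (lt_add_one _)) x hx
              exact ⟨b', lt_of_lt_of_le hb' (le_max_left _ _), hQ⟩
            · exact ⟨b, lt_of_lt_of_le (lt_add_one b) (le_max_right _ _), hb⟩
          · exact ⟨0, fun h' => absurd (lt_of_add_lt_add_right h') hz⟩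
      obtain ⟨c, hc⟩ := key (f v)
      exact ⟨c, hc (lt_add_one _)⟩
    · rintro ⟨c, hc⟩ x hx
      obtain ⟨b, -, hb⟩ := hc x hx
      exact (hPQ' v x).2 ⟨b, hb⟩

end Induction

/-! ### `Σ₁` functions, `Δ₁` relations and the least number principle. -/

section Functions

variable {M : Type*} [CommSemiring M] [LinearOrder M] [IsStrictOrderedRing M]
  [CanonicallyOrderedAdd M] {n m : ℕ} {f g : (Fin n → M) → M} {P Q : (Fin n → M) → Prop}

/-- Functions with a `Σ₁` graph. -/
structure SigmaFun (f : (Fin n → M) → M) : Prop where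
  graph : Sigma1 (fun w : Fin (n + 1) → M => w (Fin.last n) = f (fun i => w i.castSucc))

/-- `Δ₁` relations. -/
structure Delta1 (P : (Fin n → M) → Prop) : Prop where
  sigma1 : Sigma1 P
  sigma1_not : Sigma1 (fun v => ¬ P v)

theorem IsPoly.sigmaFun (hf : IsPoly f) : SigmaFun f :=
  ⟨(Delta0.eq (.var _) (hf.comp fun _ => .var _)).sigma1⟩

theorem SigmaFun.var (i : Fin n) : SigmaFun (fun v : Fin n → M => v i) := (IsPoly.var i).sigmaFun

theorem SigmaFun.const (c : M) : SigmaFun (fun _ : Fin n → M => c) := (IsPoly.const c).sigmaFun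

theorem SigmaFun.comp_poly (hf : SigmaFun f) {σ : (Fin m → M) → Fin n → M}
    (hσ : ∀ i, IsPoly (fun v => σ v i)) : SigmaFun (fun v => f (σ v)) := by
  have := Sigma1.comp hf.graph (σ := fun w : Fin (m + 1) → M => Fin.snoc (α := fun _ => M)
    (σ fun i => w i.castSucc) (w (Fin.last m))) (fun i => IsPoly.snoc
      (fun i => (hσ i).comp (σ := fun w i => w i.castSucc) fun i => .var _) (.var _) i)
  exact ⟨by simpa using this⟩

theorem Sigma1.subst {P : (Fin n → M) → M → Prop}
    (hP : Sigma1 (fun w : Fin (n + 1) → M => P (fun i => w i.castSucc) (w (Fin.last n))))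
    (hf : SigmaFun f) : Sigma1 (fun v => P v (f v)) :=
  (Sigma1.ex (P := fun v y => y = f v ∧ P v y) (Sigma1.and hf.graph hP)).congr fun v => by simp

theorem Delta1.subst {P : (Fin n → M) → M → Prop}
    (hP : Delta1 (fun w : Fin (n + 1) → M => P (fun i => w i.castSucc) (w (Fin.last n))))
    (hf : SigmaFun f) : Delta1 (fun v => P v (f v)) :=
  ⟨Sigma1.subst hP.1 hf, Sigma1.subst (P := fun v y => ¬ P v y) hP.2 hf⟩

theorem SigmaFun.subst {F : (Fin n → M) → M → M}
    (hF : SigmaFun (fun w : Fin (n + 1) → M => F (fun i => w i.castSucc) (w (Fin.last n))))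
    (hf : SigmaFun f) : SigmaFun (fun v => F v (f v)) := by
  refine ⟨Sigma1.subst (P := fun (w : Fin (n + 1) → M) y =>
    w (Fin.last n) = F (fun i => w i.castSucc) y) ?_ (hf.comp_poly fun i => .var _)⟩
  have := Sigma1.comp hF.graph (σ := fun w : Fin (n + 1 + 1) → M => Fin.snoc (α := fun _ => M)
    (Fin.snoc (α := fun _ => M) (fun i : Fin n => w i.castSucc.castSucc) (w (Fin.last (n + 1))))
    (w (Fin.last n).castSucc))
    (fun i => IsPoly.snoc (IsPoly.snoc (fun i => .var _) (.var _)) (.var _) i)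
  simpa using this

theorem SigmaFun.comp₁ {F : M → M} (hF : SigmaFun (fun v : Fin 1 → M => F (v 0)))
    (hf : SigmaFun f) : SigmaFun (fun v => F (f v)) :=
  SigmaFun.subst (F := fun _ y => F y) (hF.comp_poly (σ := fun w _ => w (Fin.last n))
    fun _ => .var _) hf

theorem SigmaFun.comp₂ {F : M → M → M} (hF : SigmaFun (fun v : Fin 2 → M => F (v 0) (v 1)))
    (hf : SigmaFun f) (hg : SigmaFun g) : SigmaFun (fun v => F (f v) (g v)) := by
  refine SigmaFun.subst (F := fun v y => F y (g v)) ?_ hf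
  refine SigmaFun.subst (F := fun w z => F (w (Fin.last n)) z) ?_ (hg.comp_poly fun i => .var _)
  refine hF.comp_poly (σ := fun w => ![w (Fin.last n).castSucc, w (Fin.last (n + 1))]) fun i => ?_
  fin_cases i
  · exact .var _
  · exact .var _

theorem Delta1.comp₂ {R : M → M → Prop} (hR : Delta1 (fun v : Fin 2 → M => R (v 0) (v 1)))
    (hf : SigmaFun f) (hg : SigmaFun g) : Delta1 (fun v => R (f v) (g v)) := by
  have key : ∀ {R : M → M → Prop}, Sigma1 (fun v : Fin 2 → M => R (v 0) (v 1)) →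
      Sigma1 (fun v => R (f v) (g v)) := by
    intro R hR
    refine Sigma1.subst (P := fun v y => R y (g v)) ?_ hf
    refine Sigma1.subst (P := fun w z => R (w (Fin.last n)) z) ?_ (hg.comp_poly fun i => .var _)
    refine hR.comp (σ := fun w => ![w (Fin.last n).castSucc, w (Fin.last (n + 1))]) fun i => ?_
    fin_cases i
    · exact .var _
    · exact .var _
  exact ⟨key hR.1, key (R := fun x y => ¬ R x y) hR.2⟩

theorem SigmaFun.add (hf : SigmaFun f) (hg : SigmaFun g) : SigmaFun (fun v => f v + g v) :=
  SigmaFun.comp₂ ((IsPoly.var 0).add (.var 1)).sigmaFun hf hg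

theorem SigmaFun.mul (hf : SigmaFun f) (hg : SigmaFun g) : SigmaFun (fun v => f v * g v) :=
  SigmaFun.comp₂ ((IsPoly.var 0).mul (.var 1)).sigmaFun hf hg

theorem SigmaFun.pair (hf : SigmaFun f) (hg : SigmaFun g) : SigmaFun (fun v => pair (f v) (g v)) :=
  SigmaFun.add (.mul (.add (.add hf hg) (.const 1)) (.add (.add hf hg) (.const 1))) hf

theorem Delta0.delta1 (hP : Delta0 P) : Delta1 P := ⟨hP.sigma1, hP.not.sigma1⟩

theorem Delta1.eq (hf : SigmaFun f) (hg : SigmaFun g) : Delta1 (fun v => f v = g v) :=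
  Delta1.comp₂ (Delta0.eq (.var 0) (.var 1)).delta1 hf hg

theorem Delta1.lt (hf : SigmaFun f) (hg : SigmaFun g) : Delta1 (fun v => f v < g v) :=
  Delta1.comp₂ (Delta0.lt (.var 0) (.var 1)).delta1 hf hg

theorem Delta1.not (hP : Delta1 P) : Delta1 (fun v => ¬ P v) := ⟨hP.2, by simpa using hP.1⟩

theorem Delta1.and (hP : Delta1 P) (hQ : Delta1 Q) : Delta1 (fun v => P v ∧ Q v) :=
  ⟨hP.1.and hQ.1, (hP.2.or hQ.2).congr fun v => by tauto⟩

theorem Delta1.or (hP : Delta1 P) (hQ : Delta1 Q) : Delta1 (fun v => P v ∨ Q v) :=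
  ⟨hP.1.or hQ.1, (hP.2.and hQ.2).congr fun v => by tauto⟩

theorem Delta1.congr (hP : Delta1 P) (h : ∀ v, Q v ↔ P v) : Delta1 Q := by
  obtain rfl : Q = P := funext fun v => propext (h v)
  exact hP

theorem Delta1.imp (hP : Delta1 P) (hQ : Delta1 Q) : Delta1 (fun v => P v → Q v) :=
  (hP.not.or hQ).congr fun v => by tauto

theorem Delta1.iff (hP : Delta1 P) (hQ : Delta1 Q) : Delta1 (fun v => P v ↔ Q v) :=
  ((hP.imp hQ).and (hQ.imp hP)).congr fun v => by tauto

theorem Delta1.le (hf : SigmaFun f) (hg : SigmaFun g) : Delta1 (fun v => f v ≤ g v) :=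
  (Delta1.lt hg hf).not.congr fun _ => not_lt.symm

theorem Sigma1.eq (hf : SigmaFun f) (hg : SigmaFun g) : Sigma1 (fun v => f v = g v) :=
  (Delta1.eq hf hg).1

theorem Sigma1.lt (hf : SigmaFun f) (hg : SigmaFun g) : Sigma1 (fun v => f v < g v) :=
  (Delta1.lt hf hg).1

theorem Sigma1.le (hf : SigmaFun f) (hg : SigmaFun g) : Sigma1 (fun v => f v ≤ g v) :=
  (Delta1.le hf hg).1

theorem Sigma1.imp (hP : Delta1 P) (hQ : Sigma1 Q) : Sigma1 (fun v => P v → Q v) :=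
  (hP.2.or hQ).congr fun v => by tauto

variable [hM : Fact (ISigma1 M)]

theorem Sigma1.ball {P : (Fin n → M) → M → Prop} (hf : SigmaFun f)
    (hP : Sigma1 (fun w : Fin (n + 1) → M => P (fun i => w i.castSucc) (w (Fin.last n)))) :
    Sigma1 (fun v => ∀ x < f v, P v x) := by
  refine Sigma1.subst (P := fun v y => ∀ x < y, P v x) ?_ hf
  refine Sigma1.ball_poly (P := fun w x => P (fun i => w i.castSucc) x) (.var _) ?_
  have := hP.comp (σ := fun w : Fin (n + 1 + 1) → M => Fin.snoc (α := fun _ => M)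
    (fun i : Fin n => w i.castSucc.castSucc) (w (Fin.last (n + 1))))
    (fun i => IsPoly.snoc (fun i => .var _) (.var _) i)
  simpa using this

theorem Delta1.ball {P : (Fin n → M) → M → Prop} (hf : SigmaFun f)
    (hP : Delta1 (fun w : Fin (n + 1) → M => P (fun i => w i.castSucc) (w (Fin.last n)))) :
    Delta1 (fun v => ∀ x < f v, P v x) :=
  ⟨Sigma1.ball hf hP.1, (Sigma1.ex (P := fun v x => x < f v ∧ ¬ P v x)
    (Sigma1.and (.lt (.var _) (hf.comp_poly fun _ => .var _)) hP.2)).congr fun v => by simp⟩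

theorem Delta1.bex {P : (Fin n → M) → M → Prop} (hf : SigmaFun f)
    (hP : Delta1 (fun w : Fin (n + 1) → M => P (fun i => w i.castSucc) (w (Fin.last n)))) :
    Delta1 (fun v => ∃ x < f v, P v x) :=
  (Delta1.ball (P := fun v x => ¬ P v x) hf hP.not).not.congr fun v => by simp

/-- The least number principle for `Δ₁` sets. -/
theorem Delta1.exists_least {P : M → Prop} (hP : Delta1 (fun v : Fin 1 → M => P (v 0)))
    {x : M} (hx : P x) : ∃ y ≤ x, P y ∧ ∀ z < y, ¬ P z := by
  by_contra! h
  -- The failure of `P` is `Σ₁` too, so this course-of-values statement is open to `Σ₁` induction.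
  have key : ∀ x, ∀ y < x, ¬ P y := by
    refine sigma1_induction ?_ (fun y hy => absurd hy (not_lt.2 zero_le)) ?_
    · refine Sigma1.ball (P := fun _ y => ¬ P y) (.var 0) ?_
      exact hP.2.comp (σ := fun w _ => w (Fin.last 1)) fun i => .var _
    · intro z hz y hy hPy
      rcases (lt_add_one_iff'.1 hy).lt_or_eq with hy | rfl
      · exact hz y hy hPy
      · rcases le_or_gt y x with hyx | hyx
        · obtain ⟨w, hw, hPw⟩ := h y hyx hPy
          exact hz w hw hPw
        -- Descent is available only up to the given `x`; beyond it, `x` itself is a smaller element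
        -- satisfying `P`.
        · exact hz x hyx hx
  exact key (x + 1) x (lt_add_one x) hx

end Functions

/-! ### Coding in models of `IΣ₁` -/

section Coding

variable {M : Type*} [CommSemiring M] [LinearOrder M] [IsStrictOrderedRing M]
  [CanonicallyOrderedAdd M] [hM : Fact (ISigma1 M)] {n : ℕ}

theorem lt_of_mul_add_eq {m q q' z z' : M} (hz' : z < m) (h : q * m + z = q' * m + z') :
    ¬ q < q' := by
  intro hq
  obtain ⟨d, rfl⟩ := exists_add_of_le (add_one_le_iff'.2 hq)
  have h' : q * m + z = q * m + (m + d * m + z') := by rw [h]; ring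
  have h'' := add_left_cancel h'
  rw [h''] at hz'
  exact absurd hz' (not_lt.2 (le_add_right le_self_add))

theorem div_mod_unique {m q q' z z' : M} (hz : z < m) (hz' : z' < m)
    (h : q * m + z = q' * m + z') : q = q' ∧ z = z' := by
  have hq : q = q' :=
    le_antisymm (not_lt.1 (lt_of_mul_add_eq hz' h.symm)) (not_lt.1 (lt_of_mul_add_eq hz h))
  subst hq
  exact ⟨rfl, add_left_cancel h⟩

theorem exists_div_mod {m : M} (hm : 0 < m) (u : M) : ∃ q z, z < m ∧ u = q * m + z := by
  refine sigma1_induction (P := fun u => ∃ q z, z < m ∧ u = q * m + z) ?_ ⟨0, 0, hm, by simp⟩ ?_ u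
  · apply_rules (maxDepth := 400) [Sigma1.ex, Sigma1.and, Sigma1.lt, Sigma1.eq, SigmaFun.add, SigmaFun.mul,
      SigmaFun.const, SigmaFun.var]
  · rintro x ⟨q, z, hz, rfl⟩
    rcases (add_one_le_iff'.2 hz).lt_or_eq with h | h
    · exact ⟨q, z + 1, h, by ring⟩
    · exact ⟨q + 1, 0, hm, by rw [← h]; ring⟩

theorem Beta.unique {u v i z z' : M} (h : Beta u v i z) (h' : Beta u v i z') : z = z' := by
  obtain ⟨hz, q, hq⟩ := h
  obtain ⟨hz', q', hq'⟩ := h'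
  exact (div_mod_unique hz hz' (hq.symm.trans hq')).2

theorem exists_beta (u v i : M) : ∃ z, Beta u v i z := by
  obtain ⟨q, z, hz, h⟩ := exists_div_mod (m := (i + 1) * v + 1)
    (lt_of_le_of_lt zero_le (lt_add_one _)) u
  exact ⟨z, hz, q, h⟩

theorem Sigma1.beta {f g h k : (Fin n → M) → M} (hf : SigmaFun f) (hg : SigmaFun g)
    (hh : SigmaFun h) (hk : SigmaFun k) : Sigma1 (fun v => Beta (f v) (g v) (h v) (k v)) := by
  unfold Beta
  have wk : ∀ {f : (Fin n → M) → M}, SigmaFun f →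
      SigmaFun (fun w : Fin (n + 1) → M => f fun i => w i.castSucc) :=
    fun hf => hf.comp_poly fun i => .var _
  apply_rules (maxDepth := 400) [Sigma1.ex, Sigma1.and, Sigma1.lt, Sigma1.eq, SigmaFun.add, SigmaFun.mul,
    SigmaFun.const, SigmaFun.var]

/-- Plays the role of a factorial: such a `v` makes the `β` moduli `(i + 1) * v + 1` pairwise
coprime and larger than the values to be coded. -/
theorem exists_common_multiple (l c : M) : ∃ v, c < v ∧ ∀ d < l, ∃ e, v = (d + 1) * e := by
  refine sigma1_induction (P := fun l => ∃ v, c < v ∧ ∀ d < l, ∃ e, v = (d + 1) * e) ?_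
    ⟨c + 1, lt_add_one c, fun d hd => absurd hd (not_lt.2 zero_le)⟩ ?_ l
  · apply_rules (maxDepth := 400) [Sigma1.ex, Sigma1.and, Sigma1.ball, Sigma1.lt, Sigma1.eq, SigmaFun.add,
      SigmaFun.mul, SigmaFun.const, SigmaFun.var]
  · rintro l ⟨v, hv, h⟩
    refine ⟨v * (l + 1), lt_of_lt_of_le hv ?_, fun d hd => ?_⟩
    · rw [mul_add, mul_one]
      exact le_add_self
    · rcases (lt_add_one_iff'.1 hd).lt_or_eq with hd | rfl
      · obtain ⟨e, he⟩ := h d hd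
        exact ⟨e * (l + 1), by rw [he]; ring⟩
      · exact ⟨v, by ring⟩

theorem sigma1_collection {R : M → M → Prop} (hR : Sigma1 (fun w : Fin 2 → M => R (w 0) (w 1)))
    (l : M) (h : ∀ i < l, ∃ y, R i y) : ∃ c, ∀ i < l, ∃ y, y < c ∧ R i y := by
  have key : ∀ z, ∃ c, z ≤ l → ∀ i < z, ∃ y, y < c ∧ R i y := by
    refine sigma1_induction ?_ ⟨0, fun _ i hi => absurd hi (not_lt.2 zero_le)⟩ ?_
    · have hR' : Sigma1 (fun w : Fin (1 + 1 + 1 + 1) → M =>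
          R (w (Fin.last (1 + 1)).castSucc) (w (Fin.last (1 + 1 + 1)))) :=
        hR.comp (σ := fun w => ![w (Fin.last (1 + 1)).castSucc, w (Fin.last (1 + 1 + 1))])
          fun i => by fin_cases i <;> exact .var _
      apply_rules (maxDepth := 400) [Sigma1.ex, Sigma1.and, Sigma1.ball, Sigma1.imp, Delta1.le, Sigma1.lt,
        SigmaFun.const, SigmaFun.var]
    · rintro z ⟨c, hc⟩
      by_cases hz : z < l
      · obtain ⟨b, hb⟩ := h z hz
        refine ⟨max c (b + 1), fun _ x hx => ?_⟩
        rcases (lt_add_one_iff'.1 hx).lt_or_eq with hx | rfl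
        · obtain ⟨b', hb', hQ⟩ := hc hz.le x hx
          exact ⟨b', lt_of_lt_of_le hb' (le_max_left _ _), hQ⟩
        · exact ⟨b, lt_of_lt_of_le (lt_add_one b) (le_max_right _ _), hb⟩
      · exact ⟨0, fun h' => absurd (add_one_le_iff'.1 h') hz⟩
  obtain ⟨c, hc⟩ := key l
  exact ⟨c, hc le_rfl⟩

/-- Gödel's `β` lemma. -/
theorem exists_beta_forall {R : M → M → Prop}
    (hR : Sigma1 (fun w : Fin 2 → M => R (w 0) (w 1))) (l : M) (h : ∀ i < l, ∃ y, R i y) :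
    ∃ u v, ∀ i < l, ∃ y, R i y ∧ Beta u v i y := by
  obtain ⟨c, hc⟩ := sigma1_collection hR l h
  obtain ⟨v, hcv, hv⟩ := exists_common_multiple l c
  -- Inductive Chinese remaindering: `D` is a common multiple of the first `k` moduli and stays
  -- invertible modulo each later one.
  suffices H : ∀ k, k ≤ l → ∃ u D,
      (∀ i < k, (∃ e, D = ((i + 1) * v + 1) * e) ∧ ∃ y, R i y ∧ Beta u v i y) ∧
      ∀ j < l, k ≤ j → ∃ a b, a * D = b * ((j + 1) * v + 1) + 1 by
    obtain ⟨u, D, hu, -⟩ := H l le_rfl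
    exact ⟨u, v, fun i hi => (hu i hi).2⟩
  refine sigma1_induction ?_ ?_ ?_
  · have hR' : Sigma1 (fun w : Fin (1 + 1 + 1 + 1 + 1) → M =>
        R (w (Fin.last (1 + 1 + 1)).castSucc) (w (Fin.last (1 + 1 + 1 + 1)))) :=
      hR.comp (σ := fun w => ![w (Fin.last (1 + 1 + 1)).castSucc, w (Fin.last (1 + 1 + 1 + 1))])
        fun i => by fin_cases i <;> exact .var _
    apply_rules (maxDepth := 400) [Sigma1.ex, Sigma1.and, Sigma1.ball, Sigma1.imp, Delta1.le, Sigma1.lt, Sigma1.beta,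
      Sigma1.eq, SigmaFun.add, SigmaFun.mul, SigmaFun.const, SigmaFun.var]
  · exact fun _ => ⟨0, 1, fun i hi => absurd hi (not_lt.2 zero_le), fun j _ _ => ⟨1, 0, by simp⟩⟩
  · intro k ih hk
    have hk' := add_one_le_iff'.1 hk
    obtain ⟨u, D, h₁, h₂⟩ := ih hk'.le
    obtain ⟨s, hs, hRs⟩ := hc k hk'
    obtain ⟨a, b, hab⟩ := h₂ k hk' le_rfl
    -- The correction is a multiple of `D`, so earlier remainders survive. Modulo the new modulus `D
    -- * a` is `1` and `(k + 1) * v` acts as `-1`, so the sum reduces to `u + s - u = s` without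
    -- subtraction.
    refine ⟨u + D * a * (s + u * ((k + 1) * v)), D * ((k + 1) * v + 1), fun i hi => ?_,
      fun j hj hkj => ?_⟩
    · rcases (lt_add_one_iff'.1 hi).lt_or_eq with hi | rfl
      · obtain ⟨⟨e, he⟩, y, hy, hyv, q, hq⟩ := h₁ i hi
        refine ⟨⟨e * ((k + 1) * v + 1), by rw [he]; ring⟩, y, hy, hyv,
          q + e * a * (s + u * ((k + 1) * v)), ?_⟩
        calc _ = q * ((i + 1) * v + 1) + y +
              ((i + 1) * v + 1) * e * a * (s + u * ((k + 1) * v)) := by rw [← hq, ← he]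
          _ = _ := by ring
      · refine ⟨⟨D, by ring⟩, s, hRs, ?_, b * (s + u * ((i + 1) * v)) + u, ?_⟩
        · refine lt_add_one_iff'.2 ((hs.trans hcv).le.trans ?_)
          rw [add_mul, one_mul]
          exact le_add_self
        · rw [mul_comm D a, hab]
          ring
    · obtain ⟨a', b', hab'⟩ := h₂ j hj ((le_add_right le_rfl).trans hkj)
      obtain ⟨d, rfl⟩ := exists_add_of_le hkj
      obtain ⟨e, he⟩ := hv d (lt_of_le_of_lt (by
        rw [add_right_comm]; exact le_add_self.trans le_self_add) hj)
      -- Write `m_i = (i + 1)v + 1` and `j = k + 1 + d`. Then `(j + 1)m_k - (k + 1)m_j = d + 1`, and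
      -- `v = (d + 1)e`, so `(j + 1)²e·m_k ≡ (j + 1)v ≡ -1` modulo `m_j`. Hence `1 + (k + 1)v(j +
      -- 1)²e` is an inverse of `m_k`; the factor `a'` inverts the old `D`.
      refine ⟨a' * (1 + (k + 1) * e * (k + 1 + d + 1) * (k + 1 + d + 1) * v),
        b' * ((k + 1) * e * ((k + 1 + d + 1) * (k + 1) * v + (d + 1)) *
          ((k + 1 + d + 1) * v + 1) + 1) +
        (k + 1) * e * ((k + 1 + d + 1) * (k + 1) * v + (d + 1)), ?_⟩
      calc _ = (a' * D) * ((1 + (k + 1) * e * (k + 1 + d + 1) * (k + 1 + d + 1) * v) *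
            ((k + 1) * v + 1)) := by ring
        _ = (a' * D) * ((k + 1) * e * ((k + 1 + d + 1) * (k + 1) * v + (d + 1)) *
            ((k + 1 + d + 1) * v + 1) + 1) := by
          congr 1
          rw [he]
          ring
        _ = _ := by
          rw [hab']
          ring

/-- Primitive recursion, in terms of `β`. -/
theorem exists_beta_rec {g : M → M → M} (hg : SigmaFun (fun v : Fin 2 → M => g (v 0) (v 1)))
    (a n : M) : ∃ u v, Beta u v 0 a ∧
      ∀ i < n, ∃ z, Beta u v i z ∧ Beta u v (i + 1) (g i z) := by
  refine sigma1_induction (P := fun n => ∃ u v, Beta u v 0 a ∧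
      ∀ i < n, ∃ z, Beta u v i z ∧ Beta u v (i + 1) (g i z)) ?_ ?_ ?_ n
  · apply_rules (maxDepth := 400) [Sigma1.ex, Sigma1.beta, Sigma1.ball, Sigma1.and,
      hg.comp₂, SigmaFun.add, SigmaFun.const, SigmaFun.var]
  · obtain ⟨u, v, h⟩ := exists_beta_forall (R := fun _ y => y = a)
      (by apply_rules [Sigma1.eq, SigmaFun.const, SigmaFun.var]) 1 (fun _ _ => ⟨a, rfl⟩)
    obtain ⟨y, rfl, hy⟩ := h 0 zero_lt_one
    exact ⟨u, v, hy, fun i hi => absurd hi (not_lt.2 zero_le)⟩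
  · rintro n ⟨u, v, h0, h⟩
    obtain ⟨z, hz⟩ := exists_beta u v n
    -- A `β` code cannot simply be prolonged, so the old sequence is recoded together with its new
    -- last entry.
    obtain ⟨u', v', h'⟩ := exists_beta_forall
      (R := fun i y => i ≤ n ∧ Beta u v i y ∨ n < i ∧ y = g n z)
      (by
        apply_rules (maxDepth := 400) [Sigma1.beta, Sigma1.or, Sigma1.and, Sigma1.le,
          Sigma1.lt, Sigma1.eq, SigmaFun.const, SigmaFun.var]) (n + 1 + 1) (fun i _ => by
        rcases le_or_gt i n with hi | hi
        · obtain ⟨y, hy⟩ := exists_beta u v i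
          exact ⟨y, .inl ⟨hi, hy⟩⟩
        · exact ⟨_, .inr ⟨hi, rfl⟩⟩)
    have old : ∀ i ≤ n, ∀ y, Beta u v i y → Beta u' v' i y := by
      intro i hi y hy
      obtain ⟨y', ⟨-, hy'⟩ | ⟨hi', -⟩, hb⟩ :=
        h' i (lt_of_le_of_lt hi ((lt_add_one n).trans (lt_add_one _)))
      · rwa [hy.unique hy']
      · exact absurd hi' (not_lt.2 hi)
    refine ⟨u', v', old 0 zero_le _ h0, fun i hi => ?_⟩
    rcases (lt_add_one_iff'.1 hi).lt_or_eq with hi | rfl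
    · obtain ⟨z, hz, hz'⟩ := h i hi
      exact ⟨z, old i hi.le _ hz, old (i + 1) (add_one_le_iff'.2 hi) _ hz'⟩
    · obtain ⟨y, ⟨hi', -⟩ | ⟨-, rfl⟩, hb⟩ := h' (i + 1) (lt_add_one _)
      · exact absurd hi' (not_le.2 (lt_add_one i))
      · exact ⟨z, old i le_rfl _ hz, hb⟩

/-- With the code fixed, `β` is a total `Σ₁` function of the index; the recursion equation is
guaranteed only below `n`. -/
theorem exists_rec {g : M → M → M} (hg : SigmaFun (fun v : Fin 2 → M => g (v 0) (v 1)))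
    (a n : M) : ∃ c : M → M, SigmaFun (fun v : Fin 1 → M => c (v 0)) ∧ c 0 = a ∧
      ∀ i < n, c (i + 1) = g i (c i) := by
  obtain ⟨u, v, h0, h⟩ := exists_beta_rec hg a n
  choose c hc using exists_beta u v
  refine ⟨c, ⟨?_⟩, (hc 0).unique h0, fun i hi => ?_⟩
  · refine Sigma1.congr (P := fun w : Fin (1 + 1) → M => Beta u v (w 0) (w (Fin.last 1))) ?_
      fun w => ⟨fun h => ?_, fun h => h.unique (hc _)⟩
    · apply_rules [Sigma1.beta, SigmaFun.const, SigmaFun.var]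
    · rw [h]
      exact hc _
  · obtain ⟨z, hz, hz'⟩ := h i hi
    rw [(hc i).unique hz]
    exact (hc _).unique hz'

/-! ### Exponentiation, binary digits and coded functions. -/

theorem exists_isPowTwo (x : M) : ∃ y, IsPowTwo x y := by
  obtain ⟨u, v, h0, h⟩ := exists_beta_rec (g := fun _ z : M => (1 + 1) * z)
    (by apply_rules [SigmaFun.add, SigmaFun.mul, SigmaFun.const, SigmaFun.var]) 1 x
  obtain ⟨y, hy⟩ := exists_beta u v x
  exact ⟨y, u, v, h0, fun i hi => h i hi, hy⟩

theorem IsPowTwo.unique {x y y' : M} (h : IsPowTwo x y) (h' : IsPowTwo x y') : y = y' := by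
  obtain ⟨u, v, h0, hs, hx⟩ := h
  obtain ⟨u', v', h0', hs', hx'⟩ := h'
  have key : ∀ i, i ≤ x → ∃ z, Beta u v i z ∧ Beta u' v' i z := by
    refine sigma1_induction ?_ (fun _ => ⟨1, h0, h0'⟩) fun i ih hi => ?_
    · apply_rules (maxDepth := 400) [Sigma1.ex, Sigma1.beta, Sigma1.and, Sigma1.imp,
        Delta1.le, SigmaFun.const, SigmaFun.var]
    · have hi' := add_one_le_iff'.1 hi
      obtain ⟨z, hz, hz'⟩ := ih hi'.le
      obtain ⟨w, hw, hw₁⟩ := hs i hi'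
      obtain ⟨w', hw', hw₁'⟩ := hs' i hi'
      rw [hw.unique hz] at hw₁
      rw [hw'.unique hz'] at hw₁'
      exact ⟨_, hw₁, hw₁'⟩
  obtain ⟨z, hz, hz'⟩ := key x le_rfl
  rw [hx.unique hz, hx'.unique hz']

/-- Base two exponentiation. -/
noncomputable def exp2 (x : M) : M := (exists_isPowTwo x).choose

theorem isPowTwo_iff {x y : M} : IsPowTwo x y ↔ y = exp2 x :=
  ⟨fun h => h.unique (exists_isPowTwo x).choose_spec,
    fun h => h ▸ (exists_isPowTwo x).choose_spec⟩

theorem sigmaFun_exp2 : SigmaFun (fun v : Fin 1 → M => exp2 (v 0)) := by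
  refine ⟨Sigma1.congr (P := fun w : Fin (1 + 1) → M => IsPowTwo (w 0) (w (Fin.last 1))) ?_
    fun w => isPowTwo_iff.symm⟩
  unfold IsPowTwo
  apply_rules (maxDepth := 400) [Sigma1.ex, Sigma1.beta, Sigma1.ball, Sigma1.and,
    SigmaFun.add, SigmaFun.mul, SigmaFun.const, SigmaFun.var]

theorem exp2_zero : exp2 (0 : M) = 1 := by
  obtain ⟨u, v, h0, -, h⟩ := (isPowTwo_iff (x := (0 : M))).2 rfl
  exact h.unique h0

theorem exp2_succ (x : M) : exp2 (x + 1) = 2 * exp2 x := by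
  obtain ⟨u, v, h0, hs, hx⟩ := (isPowTwo_iff (x := x + 1)).2 rfl
  obtain ⟨z, hz, hz'⟩ := hs x (lt_add_one x)
  rw [hx.unique hz', ← isPowTwo_iff.1 ⟨u, v, h0, fun i hi => hs i (hi.trans (lt_add_one x)), hz⟩,
    one_add_one_eq_two]

theorem lt_exp2 (x : M) : x < exp2 x := by
  refine sigma1_induction (P := fun x => x < exp2 x) ?_ (by simp [exp2_zero]) (fun x hx => ?_) x
  · apply_rules [Sigma1.lt, sigmaFun_exp2.comp₁, SigmaFun.var]
  · rw [exp2_succ, two_mul]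
    exact add_lt_add_of_lt_of_le hx (lt_of_le_of_lt zero_le hx |> fun h => by
      simpa using add_one_le_iff'.2 h)

theorem exists_exp2_add (x d : M) : ∃ t, 0 < t ∧ exp2 (x + d) = exp2 x * t := by
  refine sigma1_induction (P := fun d => ∃ t, 0 < t ∧ exp2 (x + d) = exp2 x * t) ?_
    ⟨1, zero_lt_one, by simp⟩ (fun d => ?_) d
  · apply_rules (maxDepth := 400) [Sigma1.ex, Sigma1.and, Sigma1.lt, Sigma1.eq,
      sigmaFun_exp2.comp₁, SigmaFun.add, SigmaFun.mul, SigmaFun.const, SigmaFun.var]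
  · rintro ⟨t, ht, h⟩
    exact ⟨2 * t, by positivity, by rw [← add_assoc, exp2_succ, h]; ring⟩

theorem exp2_le_exp2 {x y : M} (h : x ≤ y) : exp2 x ≤ exp2 y := by
  obtain ⟨d, rfl⟩ := exists_add_of_le h
  obtain ⟨t, ht, h⟩ := exists_exp2_add x d
  rw [h]
  calc exp2 x = exp2 x * 1 := (mul_one _).symm
    _ ≤ exp2 x * t := by
      gcongr
      simpa using add_one_le_iff'.2 ht

theorem ackMem_iff {x y : M} :
    AckMem x y ↔ ∃ q r, r < exp2 x ∧ y = (2 * q + 1) * exp2 x + r := by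
  simp only [AckMem, isPowTwo_iff, one_add_one_eq_two]
  constructor
  · rintro ⟨_, q, r, rfl, h⟩
    exact ⟨q, r, h⟩
  · rintro ⟨q, r, h⟩
    exact ⟨_, q, r, rfl, h⟩

/-- The bit is zero exactly when the quotient by `exp2 x` is even. This existential form of the
negation is what makes Ackermann membership `Δ₁`. -/
theorem not_ackMem_iff {x y : M} :
    ¬ AckMem x y ↔ ∃ q r, r < exp2 x ∧ y = 2 * q * exp2 x + r := by
  rw [ackMem_iff]
  constructor
  · intro h
    obtain ⟨p, r, hr, hy⟩ := exists_div_mod (lt_of_le_of_lt zero_le (lt_exp2 x)) y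
    obtain ⟨q, s, hs, rfl⟩ := exists_div_mod (m := (2 : M)) two_pos p
    rw [← one_add_one_eq_two, lt_add_one_iff'] at hs
    rcases hs.lt_or_eq with hs | rfl
    · rw [← zero_add (1 : M), lt_add_one_iff', nonpos_iff_eq_zero] at hs
      subst hs
      exact ⟨q, r, hr, by rw [hy]; ring⟩
    · exact absurd ⟨q, r, hr, by rw [hy]; ring⟩ h
  · rintro ⟨q, r, hr, hy⟩ ⟨q', r', hr', hy'⟩
    have h := (div_mod_unique hr hr' (hy.symm.trans hy')).1
    have h' := div_mod_unique (m := (2 : M)) (z := 0) (z' := 1) (q := q) (q' := q') two_pos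
      one_lt_two (by rw [add_zero, mul_comm, h, mul_comm])
    exact zero_ne_one h'.2

theorem Delta1.ackMem {f g : (Fin n → M) → M} (hf : SigmaFun f) (hg : SigmaFun g) :
    Delta1 (fun v => AckMem (f v) (g v)) := by
  refine Delta1.comp₂ (R := fun x y => AckMem x y) ⟨Sigma1.congr (P := fun v : Fin 2 → M =>
    ∃ q r, r < exp2 (v 0) ∧ v 1 = (2 * q + 1) * exp2 (v 0) + r) ?_ fun _ => ackMem_iff,
    Sigma1.congr (P := fun v : Fin 2 → M =>
      ∃ q r, r < exp2 (v 0) ∧ v 1 = 2 * q * exp2 (v 0) + r) ?_ fun _ => not_ackMem_iff⟩ hf hg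
  all_goals apply_rules (maxDepth := 400) [Sigma1.ex, Sigma1.and, Sigma1.lt, Sigma1.eq,
      sigmaFun_exp2.comp₁, SigmaFun.add, SigmaFun.mul, SigmaFun.const, SigmaFun.var]

theorem not_ackMem_of_lt {x y : M} (h : y < exp2 x) : ¬ AckMem x y :=
  not_ackMem_iff.2 ⟨0, y, h, by simp⟩

/-- For `x < n`, `exp2 n` is an even multiple of `exp2 x`, so adding it preserves the parity of the
quotient. -/
theorem ackMem_add_exp2_iff {x n y : M} (h : x < n) : AckMem x (y + exp2 n) ↔ AckMem x y := by
  obtain ⟨d, rfl⟩ := exists_add_of_le (add_one_le_iff'.2 h)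
  obtain ⟨t, -, ht⟩ := exists_exp2_add (x + 1) d
  rw [exp2_succ] at ht
  constructor
  · intro h
    by_contra h'
    obtain ⟨q, r, hr, rfl⟩ := not_ackMem_iff.1 h'
    exact not_ackMem_iff.2 ⟨q + t, r, hr, by rw [ht]; ring⟩ h
  · intro h
    obtain ⟨q, r, hr, rfl⟩ := ackMem_iff.1 h
    exact ackMem_iff.2 ⟨q + t, r, hr, by rw [ht]; ring⟩

/-- Comprehension for bounded `Δ₁` sets. -/
theorem exists_code {P : M → Prop} (hP : Delta1 (fun v : Fin 1 → M => P (v 0))) (n : M) :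
    ∃ y, ∀ x, AckMem x y ↔ x < n ∧ P x := by
  -- The bound on `y` excludes bits from `n` on, so adding `exp2 n` sets bit `n` without a carry.
  have key : ∃ y, y < exp2 n ∧ ∀ x < n, AckMem x y ↔ P x := by
    refine sigma1_induction (P := fun n => ∃ y, y < exp2 n ∧ ∀ x < n, AckMem x y ↔ P x) ?_
      ⟨0, by simp [exp2_zero], fun x hx => absurd hx (not_lt.2 zero_le)⟩ (fun n => ?_) n
    · have hP' : Delta1 (fun w : Fin (1 + 1 + 1) → M => P (w (Fin.last (1 + 1)))) :=
        Delta1.comp₂ (R := fun x _ : M => P x)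
          ⟨hP.1.comp (σ := fun w _ => w 0) fun _ => .var _,
            hP.2.comp (σ := fun w _ => w 0) fun _ => .var _⟩ (.var _) (.var 0)
      have hAck : Delta1 (fun w : Fin (1 + 1 + 1) → M =>
          AckMem (w (Fin.last (1 + 1))) (w (Fin.last 1).castSucc)) := .ackMem (.var _) (.var _)
      have := (hAck.iff hP').1
      apply_rules [Sigma1.ex, Sigma1.and, Sigma1.ball, Sigma1.lt, sigmaFun_exp2.comp₁,
        SigmaFun.var]
    · rintro ⟨y, hy, h⟩
      by_cases hPn : P n
      · refine ⟨y + exp2 n, by rw [exp2_succ, two_mul]; gcongr, fun x hx => ?_⟩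
        rcases (lt_add_one_iff'.1 hx).lt_or_eq with hx | rfl
        · rw [ackMem_add_exp2_iff hx, h x hx]
        · exact iff_of_true (ackMem_iff.2 ⟨0, y, hy, by ring⟩) hPn
      · refine ⟨y, hy.trans_le (exp2_le_exp2 (le_add_right le_rfl)), fun x hx => ?_⟩
        rcases (lt_add_one_iff'.1 hx).lt_or_eq with hx | rfl
        · exact h x hx
        · exact iff_of_false (not_ackMem_of_lt hy) hPn
  obtain ⟨y, hy, h⟩ := key
  refine ⟨y, fun x => ⟨fun hx => ?_, fun hx => (h x hx.1).2 hx.2⟩⟩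
  have hxn : x < n := by
    by_contra! hn
    exact not_ackMem_of_lt (hy.trans_le (exp2_le_exp2 hn)) hx
  exact ⟨hxn, (h x hxn).1 hx⟩

/-- With `s = x + y`, the code is at most `(s + 1)² + s`, which is below `(s + 2)²`. This yields
both injectivity and a bound on the codes of bounded pairs. -/
theorem pair_lt {x y x' y' : M} (h : x + y < x' + y') : pair x y < pair x' y' := by
  obtain ⟨d, hd⟩ := exists_add_of_le (add_one_le_iff'.2 h)
  unfold pair
  rw [hd]
  refine lt_of_lt_of_le (b := (x + y + 1) * (x + y + 1) + (x + y + 1)) ?_ ?_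
  · gcongr
    exact lt_add_one_iff'.2 le_self_add
  · rw [show (x + y + 1 + d + 1) * (x + y + 1 + d + 1) + x' =
      (x + y + 1) * (x + y + 1) + (x + y + 1) + ((x + y + 1) + 1 + 2 * d * (x + y + 1) + 2 * d
        + d * d + x') by ring]
    exact le_self_add

theorem pair_inj {x y x' y' : M} (h : pair x y = pair x' y') : x = x' ∧ y = y' := by
  have hs : x + y = x' + y' :=
    le_antisymm (not_lt.1 fun h' => (pair_lt h').ne h.symm) (not_lt.1 fun h' => (pair_lt h').ne h)
  unfold pair at h
  rw [hs] at h
  have hx := add_left_cancel h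
  subst hx
  exact ⟨rfl, add_left_cancel hs⟩

/-- Every bounded functional `Δ₁` relation is coded by a function. -/
theorem exists_codedFunction {R : M → M → Prop}
    (hR : Delta1 (fun v : Fin 2 → M => R (v 0) (v 1))) (n : M)
    (hn : ∀ x y, R x y → x < n ∧ y < n) (hf : ∀ x y y', R x y → R x y' → y = y') :
    ∃ f, IsCodedFunction f ∧ ∀ x y, Maps f x y ↔ R x y := by
  obtain ⟨f, h⟩ := exists_code (P := fun z => ∃ x < n, ∃ y < n, z = pair x y ∧ R x y) (by
    have hR' : Delta1 (fun w : Fin (1 + 1 + 1) → M =>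
        R (w (Fin.last 1).castSucc) (w (Fin.last (1 + 1)))) := hR.comp₂ (.var _) (.var _)
    apply_rules (maxDepth := 400) [Delta1.bex, Delta1.and, Delta1.eq, SigmaFun.pair,
      SigmaFun.const, SigmaFun.var]) (pair n n)
  have hmaps : ∀ x y, Maps f x y ↔ R x y := by
    intro x y
    rw [Maps, h]
    constructor
    · rintro ⟨-, x', -, y', -, hxy, hR⟩
      obtain ⟨rfl, rfl⟩ := pair_inj hxy
      exact hR
    · intro hxy
      obtain ⟨hx, hy⟩ := hn x y hxy
      exact ⟨pair_lt (add_lt_add hx hy), x, hx, y, hy, rfl, hxy⟩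
  refine ⟨f, ⟨fun z hz => ?_, fun x y y' hy hy' => ?_⟩, hmaps⟩
  · obtain ⟨-, x, -, y, -, h, -⟩ := (h z).1 hz
    exact ⟨x, y, h⟩
  · exact hf x y y' ((hmaps x y).1 hy) ((hmaps x y').1 hy')

end Coding

/-! ### Enumerations without repetitions -/

section Enumeration

variable {M : Type*} [CommSemiring M] [LinearOrder M] [IsStrictOrderedRing M]
  [CanonicallyOrderedAdd M] [hM : Fact (ISigma1 M)] {n : ℕ}

theorem IsProperCut.mem_of_le {I : Set M} (hI : IsProperCut I) {x y : M} (h : x ≤ y)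
    (hy : y ∈ I) : x ∈ I := by
  rcases h.lt_or_eq with h | rfl
  · exact hI.initial x y h hy
  · exact hy

theorem IsProperCut.zero_mem {I : Set M} (hI : IsProperCut I) : 0 ∈ I := by
  obtain ⟨x, hx⟩ := hI.nonempty
  exact hI.mem_of_le zero_le hx

/-- The value of `A` at `k` is not taken at any smaller argument. -/
def IsNew (A : M → M) (k : M) : Prop := ∀ m < k, A m ≠ A k

/-- Up to `l`, the function `c` counts the values of `A`. -/
structure IsCount (A c : M → M) (l : M) : Prop where
  sigmaFun : SigmaFun (fun v : Fin 1 → M => A (v 0))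
  sigmaFun_count : SigmaFun (fun v : Fin 1 → M => c (v 0))
  zero : c 0 = 0
  succ_of_isNew : ∀ k < l, IsNew A k → c (k + 1) = c k + 1
  succ_of_not_isNew : ∀ k < l, ¬ IsNew A k → c (k + 1) = c k

theorem Delta1.isNew {A : M → M} (hA : SigmaFun (fun v : Fin 1 → M => A (v 0)))
    {f : (Fin n → M) → M} (hf : SigmaFun f) : Delta1 (fun v => IsNew A (f v)) := by
  refine Delta1.subst (P := fun _ k => IsNew A k) ?_ hf
  unfold IsNew
  apply_rules (maxDepth := 400) [Delta1.ball, Delta1.not, Delta1.eq, hA.comp₁, SigmaFun.var]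

open Classical in
theorem exists_isCount {A : M → M} (hA : SigmaFun (fun v : Fin 1 → M => A (v 0))) (l : M) :
    ∃ c, IsCount A c l := by
  have hg : SigmaFun (fun v : Fin 2 → M => if IsNew A (v 0) then v 1 + 1 else v 1) := by
    refine ⟨Sigma1.congr (P := fun w : Fin (2 + 1) → M =>
      IsNew A (w 0) ∧ w (Fin.last 2) = w 1 + 1 ∨ ¬ IsNew A (w 0) ∧ w (Fin.last 2) = w 1) ?_
      fun w => ?_⟩
    · have := Delta1.isNew hA (.var (0 : Fin (2 + 1)))
      apply_rules [Sigma1.or, Sigma1.and, this.sigma1, this.not.sigma1, Sigma1.eq, SigmaFun.add,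
        SigmaFun.const, SigmaFun.var]
    · change w (Fin.last 2) = ite (IsNew A (w 0)) _ _ ↔ _
      split_ifs with h
      · simp [h]
      · simp [h]
  obtain ⟨c, hc, h0, hs⟩ := exists_rec (g := fun k z => if IsNew A k then z + 1 else z) hg 0 l
  exact ⟨c, hA, hc, h0, fun k hk h => by rw [hs k hk, if_pos h],
    fun k hk h => by rw [hs k hk, if_neg h]⟩

/-! ### Counting first occurrences, and cofinality of the count. -/

namespace IsCount

variable {A c : M → M} {l : M}

theorem le_succ (h : IsCount A c l) {k : M} (hk : k < l) : c k ≤ c (k + 1) := by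
  by_cases hn : IsNew A k
  · rw [h.succ_of_isNew k hk hn]
    exact le_self_add
  · rw [h.succ_of_not_isNew k hk hn]

theorem succ_le (h : IsCount A c l) {k : M} (hk : k < l) : c (k + 1) ≤ c k + 1 := by
  by_cases hn : IsNew A k
  · rw [h.succ_of_isNew k hk hn]
  · rw [h.succ_of_not_isNew k hk hn]
    exact le_self_add

theorem mono (h : IsCount A c l) {j k : M} (hjk : j ≤ k) (hk : k ≤ l) : c j ≤ c k := by
  obtain ⟨d, rfl⟩ := exists_add_of_le hjk
  refine sigma1_induction (P := fun d => j + d ≤ l → c j ≤ c (j + d)) ?_ (by simp)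
    (fun d ih hd => ?_) d hk
  · apply_rules [Sigma1.imp, Delta1.le, Sigma1.le, h.sigmaFun_count.comp₁, SigmaFun.add,
      SigmaFun.const, SigmaFun.var]
  · rw [← add_assoc] at hd ⊢
    have hd' := add_one_le_iff'.1 hd
    exact (ih hd'.le).trans (h.le_succ hd')

theorem le_self (h : IsCount A c l) {k : M} (hk : k ≤ l) : c k ≤ k := by
  refine sigma1_induction (P := fun k => k ≤ l → c k ≤ k) ?_ (by simp [h.zero])
    (fun k ih hk => ?_) k hk
  · apply_rules [Sigma1.imp, Delta1.le, Sigma1.le, h.sigmaFun_count.comp₁, SigmaFun.const,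
      SigmaFun.var]
  · have hk' := add_one_le_iff'.1 hk
    exact (h.succ_le hk').trans (by gcongr; exact ih hk'.le)

/-- A discrete intermediate value argument: `c` starts at `0` and rises by one exactly at new
indices. -/
theorem exists_isNew_eq (h : IsCount A c l) {i k : M} (hk : k ≤ l) (hi : i < c k) :
    ∃ j < k, IsNew A j ∧ c j = i := by
  refine sigma1_induction (P := fun k => k ≤ l → i < c k → ∃ j, j < k ∧ IsNew A j ∧ c j = i) ?_
    (fun _ hi => absurd hi (by simp [h.zero])) (fun k ih hk hi => ?_) k hk hi
  · have := (Delta1.isNew h.sigmaFun (.var (Fin.last 1))).sigma1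
    apply_rules (maxDepth := 400) [Sigma1.imp, Delta1.le, Delta1.lt, Sigma1.ex, Sigma1.and,
      Sigma1.lt, Sigma1.eq, h.sigmaFun_count.comp₁, SigmaFun.const, SigmaFun.var]
  · have hk' := add_one_le_iff'.1 hk
    rcases lt_or_ge i (c k) with hik | hik
    · obtain ⟨j, hj, hj'⟩ := ih hk'.le hik
      exact ⟨j, hj.trans (lt_add_one k), hj'⟩
    · by_cases hn : IsNew A k
      · rw [h.succ_of_isNew k hk' hn, lt_add_one_iff'] at hi
        exact ⟨k, lt_add_one k, hn, le_antisymm hik hi⟩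
      · rw [h.succ_of_not_isNew k hk' hn] at hi
        exact absurd hi (not_lt.2 hik)

theorem lt_of_isNew (h : IsCount A c l) {j k : M} (hjk : j < k) (hk : k ≤ l) (hj : IsNew A j) :
    c j < c k := by
  refine (lt_add_one (c j)).trans_le ?_
  rw [← h.succ_of_isNew j (hjk.trans_le hk) hj]
  exact h.mono (add_one_le_iff'.2 hjk) hk

theorem eq_of_isNew (h : IsCount A c l) {j k : M} (hj : j < l) (hk : k < l) (hj' : IsNew A j)
    (hk' : IsNew A k) (hjk : c j = c k) : j = k := by
  rcases lt_trichotomy j k with hlt | heq | hlt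
  · exact absurd hjk (h.lt_of_isNew hlt hk.le hj').ne
  · exact heq
  · exact absurd hjk (h.lt_of_isNew hlt hj.le hk').ne'

/-- If the counting function is cofinal in the cut `I`, the set of values of `A` on `I` can be
enumerated without repetitions. -/
theorem isISmall (h : IsCount A c l) {I : Set M} (hI : IsProperCut I) (hl : ∀ i ∈ I, i < l)
    (hc : ∀ i ∈ I, ∃ k ∈ I, i < c k) : IsISmall I {x | ∃ i ∈ I, A i = x} := by
  have hA := h.sigmaFun
  have hc' : ∀ i ∈ I, ∃ k ∈ I, IsNew A k ∧ c k = i := fun i hi => by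
    obtain ⟨k, hk, hik⟩ := hc i hi
    obtain ⟨j, hj, hj'⟩ := h.exists_isNew_eq (hl k hk).le hik
    exact ⟨j, hI.initial j k hj hk, hj'⟩
  -- Collection bounds the values of `A` below `l`, as needed to code the new enumeration by one
  -- element.
  obtain ⟨B, hB⟩ := sigma1_collection (R := fun k x => x = A k)
    (by apply_rules [Sigma1.eq, hA.comp₁, SigmaFun.var]) l fun i _ => ⟨_, rfl⟩
  obtain ⟨b, hb, hR⟩ := exists_codedFunction
    (R := fun i x => ∃ k < l, IsNew A k ∧ c k = i ∧ A k = x) (by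
      have := Delta1.isNew hA (.var (Fin.last 2))
      apply_rules (maxDepth := 400) [Delta1.bex, Delta1.and, Delta1.eq, hA.comp₁,
        h.sigmaFun_count.comp₁, SigmaFun.const, SigmaFun.var]) (max l B)
    (by
      rintro i x ⟨k, hk, -, rfl, rfl⟩
      obtain ⟨y, hy, rfl⟩ := hB k hk
      exact ⟨((h.le_self hk.le).trans_lt hk).trans_le (le_max_left _ _),
        hy.trans_le (le_max_right _ _)⟩)
    (by
      rintro i x y ⟨k, hk, hk', rfl, rfl⟩ ⟨j, hj, hj', hjk, rfl⟩
      rw [h.eq_of_isNew hj hk hj' hk' hjk])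
  refine ⟨b, ⟨⟨hb, c l, fun i => ⟨?_, fun hi => ?_⟩⟩, fun i hi => ?_, Set.ext fun x => ?_⟩, ?_⟩
  · rintro ⟨x, hx⟩
    obtain ⟨k, hk, hk', rfl, -⟩ := (hR i x).1 hx
    exact h.lt_of_isNew hk le_rfl hk'
  · obtain ⟨k, hk, hk', hki⟩ := h.exists_isNew_eq le_rfl hi
    exact ⟨_, (hR _ _).2 ⟨k, hk, hk', hki, rfl⟩⟩
  · obtain ⟨k, hk, hk', hki⟩ := hc' i hi
    exact ⟨_, (hR _ _).2 ⟨k, hl k hk, hk', hki, rfl⟩⟩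
  · constructor
    · rintro ⟨i, hi, rfl⟩
      -- The first occurrence of the value is new and lies in `I`, and its count is no larger than
      -- itself.
      obtain ⟨k, hki, hk, hk'⟩ := Delta1.exists_least (P := fun k => A k = A i)
        (by apply_rules [Delta1.eq, hA.comp₁, SigmaFun.const, SigmaFun.var]) rfl
      have hkI := hI.mem_of_le hki hi
      exact ⟨c k, hI.mem_of_le (h.le_self (hl k hkI).le) hkI,
        (hR _ _).2 ⟨k, hl k hkI, fun m hm => hk ▸ hk' m hm, rfl, hk⟩⟩
    · rintro ⟨i, hi, hx⟩
      obtain ⟨k, hk, hk', rfl, rfl⟩ := (hR _ _).1 hx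
      -- The index `k` is only known to be below `l`. Cofinality supplies a new index in `I` with
      -- the same count, which must equal `k`.
      obtain ⟨j, hj, hj', hjk⟩ := hc' _ hi
      exact ⟨k, h.eq_of_isNew (hl j hj) hk hj' hk' hjk ▸ hj, rfl⟩
  · rintro i - j - hij x y hx hy rfl
    obtain ⟨k, -, hk, rfl, hkx⟩ := (hR _ _).1 hx
    obtain ⟨m, -, hm, rfl, hmx⟩ := (hR _ _).1 hy
    have hkm : A k = A m := hkx.trans hmx.symm
    rcases lt_trichotomy k m with hlt | heq | hlt
    · exact hm k hlt hkm
    · exact hij (by rw [heq])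
    · exact hk m hlt hkm.symm

/-- Successor closure makes one more than the maximum of `A` below `k` a value on `I`; its first
occurrence cannot lie below `k`. -/
theorem exists_isNew_ge (h : IsCount A c l) {I : Set M} (hI : IsProperCut I)
    (hX : ∀ i ∈ I, ∃ j ∈ I, A j = A i + 1) {k : M} (hk : k ∈ I) :
    ∃ k' ∈ I, k ≤ k' ∧ IsNew A k' := by
  have hA := h.sigmaFun
  have hmax : k = 0 ∨ ∃ m, m < k ∧ ∀ m' < k, A m' ≤ A m := by
    refine sigma1_induction (P := fun k => k = 0 ∨ ∃ m, m < k ∧ ∀ m' < k, A m' ≤ A m) ?_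
      (.inl rfl) (fun k ih => .inr ?_) k
    · apply_rules (maxDepth := 400) [Sigma1.or, Sigma1.ex, Sigma1.and, Sigma1.ball, Sigma1.lt,
        Sigma1.le, Sigma1.eq, hA.comp₁, SigmaFun.const, SigmaFun.var]
    · rcases ih with rfl | ⟨m, hm, hm'⟩
      · refine ⟨0, lt_add_one 0, fun m' hm' => ?_⟩
        rw [lt_add_one_iff', nonpos_iff_eq_zero] at hm'
        rw [hm']
      · rcases le_total (A k) (A m) with hle | hle
        · refine ⟨m, hm.trans (lt_add_one k), fun m' h' => ?_⟩
          rcases (lt_add_one_iff'.1 h').lt_or_eq with h' | rfl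
          · exact hm' m' h'
          · exact hle
        · refine ⟨k, lt_add_one k, fun m' h' => ?_⟩
          rcases (lt_add_one_iff'.1 h').lt_or_eq with h' | rfl
          · exact (hm' m' h').trans hle
          · exact le_rfl
  rcases hmax with rfl | ⟨m, hm, hm'⟩
  · exact ⟨0, hk, le_rfl, fun m hm => absurd hm (not_lt.2 zero_le)⟩
  · obtain ⟨j, hj, hjm⟩ := hX m (hI.initial m k hm hk)
    obtain ⟨k', hk'j, hk', hlt⟩ := Delta1.exists_least (P := fun k => A k = A m + 1)
      (by apply_rules [Delta1.eq, hA.comp₁, SigmaFun.add, SigmaFun.const, SigmaFun.var]) hjm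
    refine ⟨k', hI.mem_of_le hk'j hj, not_lt.1 fun hlt' => ?_, fun i hi => hk' ▸ hlt i hi⟩
    exact absurd (hm' k' hlt') (not_le.2 (hk' ▸ lt_add_one _))

theorem exists_lt_zero (h : IsCount A c l) {I : Set M} (hI : IsProperCut I)
    (hl : ∀ i ∈ I, i < l) (hX : ∀ i ∈ I, ∃ j ∈ I, A j = A i + 1) : ∃ k ∈ I, 0 < c k := by
  obtain ⟨k, hk, -, hk'⟩ := h.exists_isNew_ge hI hX hI.zero_mem
  refine ⟨k + 1, hI.succ_mem k hk, ?_⟩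
  rw [h.succ_of_isNew k (hl k hk) hk']
  exact lt_add_one_iff'.2 zero_le

theorem exists_lt_succ (h : IsCount A c l) {I : Set M} (hI : IsProperCut I)
    (hl : ∀ i ∈ I, i < l) (hX : ∀ i ∈ I, ∃ j ∈ I, A j = A i + 1) {i k : M} (hk : k ∈ I)
    (hi : i < c k) : ∃ k ∈ I, i + 1 < c k := by
  obtain ⟨k', hk', hkk', hn⟩ := h.exists_isNew_ge hI hX hk
  refine ⟨k' + 1, hI.succ_mem k' hk', ?_⟩
  rw [h.succ_of_isNew k' (hl k' hk') hn]
  gcongr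
  exact hi.trans_le (h.mono hkk' (hl k' hk').le)

theorem cofinal_of_eq_standardCut (h : IsCount A c l) {I : Set M} (hI : IsProperCut I)
    (hl : ∀ i ∈ I, i < l) (hX : ∀ i ∈ I, ∃ j ∈ I, A j = A i + 1) (hN : I = standardCut M) :
    ∀ i ∈ I, ∃ k ∈ I, i < c k := by
  intro i hi
  rw [hN] at hi
  obtain ⟨n, rfl⟩ := hi
  induction n with
  | zero => exact h.exists_lt_zero hI hl hX
  | succ n ih =>
    obtain ⟨k, hk, hnk⟩ := ih
    exact h.exists_lt_succ hI hl hX hk hnk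

theorem cofinal_of_isStrong (h : IsCount A c l) {I : Set M} (hI : IsProperCut I)
    (hl : ∀ i ∈ I, i < l) (hX : ∀ i ∈ I, ∃ j ∈ I, A j = A i + 1) (hS : IsStrong I) :
    ∀ i ∈ I, ∃ k ∈ I, i < c k := by
  have hcc := h.sigmaFun_count
  -- The graph of the least `k` with `i < c k`, with default value `l` so that the function is
  -- defined on all of `I`.
  have hD : Delta1 (fun v : Fin 2 → M =>
      v 0 < l ∧ v 1 ≤ l ∧ (∀ m < v 1, c m ≤ v 0) ∧ (v 1 = l ∨ v 0 < c (v 1))) := by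
    apply_rules (maxDepth := 400) [Delta1.and, Delta1.or, Delta1.ball, Delta1.lt, Delta1.le,
      Delta1.eq, hcc.comp₁, SigmaFun.const, SigmaFun.var]
  have hleast : ∀ i < l, ∀ k ≤ l, (k = l ∨ i < c k) → ∃ k' ≤ k,
      i < l ∧ k' ≤ l ∧ (∀ m < k', c m ≤ i) ∧ (k' = l ∨ i < c k') := by
    intro i hi k hk hik
    obtain ⟨k', hk', hP, hlt⟩ := Delta1.exists_least (P := fun k => k = l ∨ i < c k)
      (by apply_rules [Delta1.or, Delta1.lt, Delta1.eq, hcc.comp₁, SigmaFun.const, SigmaFun.var])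
      hik
    exact ⟨k', hk', hi, hk'.trans hk, fun m hm => not_lt.1 fun hm' => hlt m hm (.inr hm'), hP⟩
  obtain ⟨f, hf, hR⟩ := exists_codedFunction (R := fun i k =>
      i < l ∧ k ≤ l ∧ (∀ m < k, c m ≤ i) ∧ (k = l ∨ i < c k)) hD (l + 1)
    (fun i k hik => ⟨hik.1.trans (lt_add_one l), lt_add_one_iff'.2 hik.2.1⟩) (by
      have key : ∀ i k k', (k = l ∨ i < c k) → k' ≤ l → (∀ m < k', c m ≤ i) → ¬ k < k' := by
        rintro i k k' (rfl | hik) hk' hm hlt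
        · exact absurd hlt (not_lt.2 hk')
        · exact absurd (hm k hlt) (not_le.2 hik)
      rintro i k k' ⟨-, hkl, hm, hk⟩ ⟨-, hkl', hm', hk'⟩
      exact le_antisymm (not_lt.1 (key i k' k hk' hkl hm)) (not_lt.1 (key i k k' hk hkl' hm')))
  obtain ⟨e, -, he⟩ := hS f hf fun i hi => by
    obtain ⟨k, -, hk⟩ := hleast i (hl i hi) l le_rfl (.inl rfl)
    exact ⟨k, (hR i k).2 hk⟩
  intro i₀ hi₀
  -- Together with `above`, this replaces the external condition that the count exceeds `i` within
  -- `I` by the `Σ₁` condition that the coded value is below `e`.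
  have below : ∀ i ≤ i₀, (∃ k ∈ I, i < c k) → ∃ k, k < e ∧ Maps f i k := by
    rintro i hi ⟨k, hk, hik⟩
    have hiI := hI.mem_of_le hi hi₀
    obtain ⟨k', hk', hR'⟩ := hleast i (hl i hiI) k (hl k hk).le (.inr hik)
    have hmaps := (hR i k').2 hR'
    exact ⟨k', (he i hiI k' hmaps).1 (hI.mem_of_le hk' hk), hmaps⟩
  have above : ∀ i ≤ i₀, (∃ k, k < e ∧ Maps f i k) → ∃ k ∈ I, i < c k := by
    rintro i hi ⟨k, hk, hmaps⟩
    have hkI := (he i (hI.mem_of_le hi hi₀) k hmaps).2 hk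
    obtain ⟨-, -, -, rfl | hik⟩ := (hR i k).1 hmaps
    -- The default value `l` lies above `I`, so a value in `I` is a genuine witness.
    · exact absurd (hl _ hkI) (lt_irrefl _)
    · exact ⟨k, hkI, hik⟩
  -- The induction stops at `i₀`, since strength gives the equivalence only for arguments in `I`.
  refine above i₀ le_rfl (sigma1_induction (P := fun i => i ≤ i₀ → ∃ k, k < e ∧ Maps f i k) ?_
    (fun h0 => below 0 h0 (h.exists_lt_zero hI hl hX)) (fun i ih hi => ?_) i₀ le_rfl)
  · have : Sigma1 (fun w : Fin (1 + 1) → M => Maps f (w 0) (w (Fin.last 1))) :=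
      (Delta1.ackMem (.pair (.var _) (.var _)) (.const f)).sigma1
    apply_rules (maxDepth := 400) [Sigma1.imp, Sigma1.ex, Sigma1.and, Delta1.le, Sigma1.lt,
      SigmaFun.const, SigmaFun.var]
  · have hi' := (add_one_le_iff'.1 hi).le
    obtain ⟨k, hk, hik⟩ := above i hi' (ih hi')
    exact below _ hi (h.exists_lt_succ hI hl hX hk hik)

end IsCount

/-- The coded sequence is extended by `0` beyond its length, because the definability calculus works
with total functions. -/
theorem Enumerates.exists_sigmaFun {a : M} {I X : Set M} (h : Enumerates a I X) :
    ∃ (A : M → M) (l : M), SigmaFun (fun v : Fin 1 → M => A (v 0)) ∧ (∀ i ∈ I, i < l) ∧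
      X = {x | ∃ i ∈ I, A i = x} := by
  obtain ⟨⟨⟨-, hfun⟩, l, hl⟩, hI, rfl⟩ := h
  have hA : ∀ i, ∃ y, i < l ∧ Maps a i y ∨ l ≤ i ∧ y = 0 := fun i => by
    rcases lt_or_ge i l with hi | hi
    · obtain ⟨y, hy⟩ := (hl i).2 hi
      exact ⟨y, .inl ⟨hi, hy⟩⟩
    · exact ⟨0, .inr ⟨hi, rfl⟩⟩
  choose A hA using hA
  have hmaps : ∀ i < l, ∀ y, Maps a i y ↔ A i = y := fun i hi y => by
    rcases hA i with ⟨-, h⟩ | ⟨h, -⟩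
    · exact ⟨hfun i _ _ h, fun e => e ▸ h⟩
    · exact absurd hi (not_lt.2 h)
  refine ⟨A, l, ⟨Sigma1.congr (P := fun w : Fin (1 + 1) → M =>
    w 0 < l ∧ Maps a (w 0) (w (Fin.last 1)) ∨ l ≤ w 0 ∧ w (Fin.last 1) = 0) ?_ fun w => ?_⟩,
    fun i hi => (hl i).1 (hI hi), Set.ext fun x => ?_⟩
  · have : Sigma1 (fun w : Fin (1 + 1) → M => Maps a (w 0) (w (Fin.last 1))) :=
      (Delta1.ackMem (.pair (.var _) (.var _)) (.const a)).sigma1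
    apply_rules [Sigma1.or, Sigma1.and, Sigma1.lt, Sigma1.le, Sigma1.eq, SigmaFun.const,
      SigmaFun.var]
  · change w (Fin.last 1) = A (w 0) ↔ _
    rcases lt_or_ge (w 0) l with hi | hi
    · rw [hmaps _ hi]
      simp [hi, not_le.2 hi, eq_comm]
    · rcases hA (w 0) with ⟨h, -⟩ | ⟨-, h⟩
      · exact absurd h (not_lt.2 hi)
      · simp [hi, not_lt.2 hi, h]
  · exact exists_congr fun i => and_congr_right fun hi => hmaps i ((hl i).1 (hI hi)) x

theorem Enumerates.isISmall {a : M} {I X : Set M} (h : Enumerates a I X) (hI : IsProperCut I)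
    (hX : ∀ x ∈ X, x + 1 ∈ X) (hI' : I = standardCut M ∨ IsStrong I) : IsISmall I X := by
  obtain ⟨A, l, hA, hl, rfl⟩ := h.exists_sigmaFun
  have hX' : ∀ i ∈ I, ∃ j ∈ I, A j = A i + 1 := fun i hi => hX (A i) ⟨i, hi, rfl⟩
  obtain ⟨c, hc⟩ := exists_isCount hA l
  refine hc.isISmall hI hl ?_
  rcases hI' with hN | hS
  · exact hc.cofinal_of_eq_standardCut hI hl hX' hN
  · exact hc.cofinal_of_isStrong hI hl hX' hS

end Enumeration

/-! ### Models of `PA⁻` as ordered semirings. -/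

section Instances

variable {M : Type*} [Zero M] [One M] [Add M] [Mul M] [LT M]

theorem PAMinus.zero_add (h : PAMinus M) (x : M) : 0 + x = x := by
  rw [h.add_comm, h.add_zero]

theorem PAMinus.le_of_exists_add (h : PAMinus M) (x z : M) : x < x + z ∨ x = x + z := by
  rcases h.zero_le z with rfl | hz
  · exact .inr (h.add_zero x).symm
  · left
    have := h.add_lt_add 0 z x hz
    rwa [h.zero_add, h.add_comm] at this

/-- A model of `PA⁻` as a commutative semiring. -/
abbrev PAMinus.commSemiring (h : PAMinus M) : CommSemiring M where
  add_assoc := h.add_assoc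
  zero_add := h.zero_add
  add_zero := h.add_zero
  add_comm := h.add_comm
  nsmul := nsmulRec
  mul_assoc := h.mul_assoc
  mul_comm := h.mul_comm
  one_mul x := by rw [h.mul_comm, h.mul_one]
  mul_one := h.mul_one
  left_distrib := h.mul_add
  right_distrib x y z := by rw [h.mul_comm, h.mul_add, h.mul_comm z x, h.mul_comm z y]
  zero_mul x := by rw [h.mul_comm, h.mul_zero]
  mul_zero := h.mul_zero

open Classical in
/-- The linear order of a model of `PA⁻`. -/
noncomputable abbrev PAMinus.linearOrder (h : PAMinus M) : LinearOrder M where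
  le x y := x < y ∨ x = y
  le_refl x := .inr rfl
  le_trans x y z := by
    rintro (hxy | rfl) (hyz | rfl)
    · exact .inl (h.lt_trans _ _ _ hxy hyz)
    · exact .inl hxy
    · exact .inl hyz
    · exact .inr rfl
  lt_iff_le_not_ge x y := by
    constructor
    · refine fun hxy => ⟨.inl hxy, ?_⟩
      rintro (hyx | rfl)
      · exact h.lt_irrefl _ (h.lt_trans _ _ _ hxy hyx)
      · exact h.lt_irrefl _ hxy
    · rintro ⟨hxy | rfl, hyx⟩
      · exact hxy
      · exact absurd (.inr rfl) hyx
  le_antisymm x y := by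
    rintro (hxy | rfl) (hyx | hyx)
    · exact absurd (h.lt_trans _ _ _ hxy hyx) (h.lt_irrefl _)
    · exact hyx.symm
    · rfl
    · rfl
  le_total x y := by
    rcases h.lt_trichotomy x y with hxy | rfl | hyx
    · exact .inl (.inl hxy)
    · exact .inl (.inr rfl)
    · exact .inr (.inl hyx)
  toDecidableLE := fun _ _ => propDecidable _

theorem PAMinus.isStrictOrderedRing (h : PAMinus M) :
    letI := h.commSemiring
    letI := h.linearOrder
    IsStrictOrderedRing M := by
  let _ := h.commSemiring
  let _ := h.linearOrder
  have hadd : ∀ x y z : M, x ≤ y → x + z ≤ y + z := by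
    rintro x y z (hxy | rfl)
    · exact .inl (h.add_lt_add _ _ _ hxy)
    · exact .inr rfl
  have : IsOrderedCancelAddMonoid M :=
    { add_le_add_left := fun x y hxy z => hadd x y z hxy
      le_of_add_le_add_left := fun x y z hyz => by
        by_contra! hlt
        have := h.add_lt_add z y x hlt
        rw [h.add_comm z, h.add_comm y] at this
        exact absurd hyz (not_le.2 this) }
  have : Nontrivial M := ⟨0, 1, fun h01 => h.lt_irrefl (0 : M) (h01.symm ▸ h.zero_lt_one)⟩
  have : ZeroLEOneClass M := ⟨.inl h.zero_lt_one⟩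
  have hmul : ∀ x y z : M, 0 < z → x < y → x * z < y * z := fun x y z hz => h.mul_lt_mul x y z hz
  exact
    { mul_lt_mul_of_pos_left := fun z hz x y hxy => by
        simpa only [_root_.mul_comm z] using hmul x y z hz hxy
      mul_lt_mul_of_pos_right := fun z hz x y hxy => hmul x y z hz hxy }

theorem PAMinus.canonicallyOrderedAdd (h : PAMinus M) :
    letI := h.commSemiring
    letI := h.linearOrder
    CanonicallyOrderedAdd M := by
  let _ := h.commSemiring
  let _ := h.linearOrder
  exact
    { exists_add_of_le := by
        rintro x y (hxy | rfl)
        · obtain ⟨z, rfl⟩ := h.exists_add_of_lt x y hxy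
          exact ⟨z, rfl⟩
        · exact ⟨0, (h.add_zero x).symm⟩
      le_add_self := fun x z => (h.add_comm x z) ▸ h.le_of_exists_add x z
      le_self_add := fun x z => h.le_of_exists_add x z }

end Instances

end Arith

theorem lemma3p1 {M : Type*} [Zero M] [One M] [Add M] [Mul M] [LT M]
    (hM : Arith.ISigma1 M) (hns : Arith.IsNonstandard M)
    (I : Set M) (hI : Arith.IsProperCut I)
    (M₀ : Arith.arith.Substructure M)
    (hM₀ : ∃ a : M, Arith.Enumerates a I (M₀ : Set M)) :
    (I = Arith.standardCut M → Arith.IsSmall (M₀ : Set M)) ∧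
      (Arith.IsStrong I → Arith.IsISmall I (M₀ : Set M)) := by
  have hsucc : ∀ x ∈ (M₀ : Set M), x + 1 ∈ (M₀ : Set M) := fun x hx =>
    M₀.fun_mem (Arith.Func.add : Arith.arith.Functions 2) ![x, 1] fun i => by
      refine Fin.cases hx (fun i => ?_) i
      obtain rfl : i = 0 := Subsingleton.elim _ _
      exact M₀.fun_mem (Arith.Func.one : Arith.arith.Functions 0) ![] fun i => i.elim0
  obtain ⟨a, ha⟩ := hM₀
  have key : I = Arith.standardCut M ∨ Arith.IsStrong I → Arith.IsISmall I (M₀ : Set M) := by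
    -- These structures reuse the given operations and order, so the coding notions keep their
    -- original meaning.
    let _ := hM.toPAMinus.commSemiring
    let _ := hM.toPAMinus.linearOrder
    have := hM.toPAMinus.isStrictOrderedRing
    have := hM.toPAMinus.canonicallyOrderedAdd
    have : Fact (Arith.ISigma1 M) := ⟨hM⟩
    exact Arith.Enumerates.isISmall ha hI hsucc
  refine ⟨fun h => ?_, fun h => key (.inr h)⟩
  have := key (.inl h)
  rwa [h] at this
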